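/- Let $\mathcal Y\subset\mathbb R$ and for each $y\in\mathcal Y$ let $\ell_y:\mathbb R\to\mathbb R$ be a $C^1$, strictly convex function, with $y\mapsto\ell_y(u)$ measurable for every $u$. Let $U,G$ be standard normal random variables and $Y$ a $\mathcal Y$-valued random variable, with $G$ independent of $(U,Y)$. Let $$\Omega_\vee=\{\ell_Y\text{ is coercive}\},\quad \Omega_\nearrow=\{\ell_Y\text{ is strictly increasing}\},\quad \Omega_\searrow=\{\ell_Y\text{ is strictly decreasing}\},$$ where coercive means $\ell_Y(u)\to+\infty$ as $|u|\to\infty$. Assume: 1. $\mathbb E\bigl[U^2(I\{\Omega_\vee\}+I\{\Omega_\searrow,U>0\}+I\{\Omega_\nearrow,U<0\})\bigr]>0$ and $\mathbb E\bigl[U^2(I\{\Omega_\vee\}+I\{\Omega_\searrow,U<0\}+I\{\Omega_\nearrow,U>0\})\bigr]>0$; 2. $\mathbb E|\inf_u\ell_Y(u)|<\infty$ (in particular the infimum is almost surely finite) and $\mathbb E|\ell_Y(G)|<\infty$; 3. $\mathbb P(\Omega_\vee)<1$; 4. there are a constant $b>0$ and a positive $\sigma(Y)$-measurable random variable $D(Y)$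 with $\mathbb E[D(Y)]<\infty$ and $\mathbb E[D(Y)^2I\{\Omega_\vee\}]<\infty$ such that, almost surely, for all $u\in\mathbb R$, $\ell_Y(u)\ge -D(Y)+u/b$ on $\Omega_\nearrow$, $\ell_Y(u)\ge -D(Y)+|u|/b$ on $\Omega_\vee$, and $\ell_Y(u)\ge -D(Y)-u/b$ on $\Omega_\searrow$. Define the threshold $\delta_\infty\in(0,+\infty]$ by $1/\delta_\infty=\inf_{t\in\mathbb R}\varphi(t)$ (with $\delta_\infty=+\infty$ if the infimum is $0$), where $$\varphi(t)=\mathbb E\bigl[(G+Ut)^2I\{\Omega_\vee\}\bigr]+\mathbb E\bigl[\max(G+Ut,0)^2I\{\Omega_\nearrow\}\bigr]+\mathbb E\bigl[\max(-(G+Ut),0)^2I\{\Omega_\searrow\}\bigr].$$ For a convex $f:\mathbb R\to\mathbb R$ let $\mathrm{prox}[f](x)$ be the unique minimizer of $u\mapsto\frac12(x-u)^2+f(u)$. For $\delta\in(1,\infty)$ consider the system in the unknowns $(\gamma,a,\sigma)\in\mathbb R_{>0}\times\mathbb R\times\mathbb R_{>0}$ $$\begin{aligned} \gamma^{-2}\delta^{-1}\sigma^2&=\mathbb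 E\bigl[\ell_Y'(\mathrm{prox}[\gamma\ell_Y](aU+\sigma G))^2\bigr],\\ 0&=\mathbb E\bigl[U\,\ell_Y'(\mathrm{prox}[\gamma\ell_Y](aU+\sigma G))\bigr],\\ \sigma(1-\delta^{-1})&=\mathbb E\bigl[G\,\mathrm{prox}[\gamma\ell_Y](aU+\sigma G)\bigr]. \end{aligned}$$ All three expectations are well defined and finite for all $\gamma,\sigma>0$ and $a\in\mathbb R$, and: - if $\delta\le\delta_\infty$, the system has no solution; - if $\delta>\delta_\infty$, the system has a unique solution. -/

import Mathlib

open MeasureTheory ProbabilityTheory Filter Set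

noncomputable section

/-- The proximal operator of `f : ℝ → ℝ`: `prox f x` is the minimizer over `u` of
`(x - u) ^ 2 / 2 + f u`. It exists and is unique for convex `f`, see `isMinOn_iff_eq_prox`. -/
def prox (f : ℝ → ℝ) (x : ℝ) : ℝ :=
  Classical.epsilon fun p => IsMinOn (fun u => (x - u) ^ 2 / 2 + f u) univ p

theorem isMinOn_iff_eq_prox {f : ℝ → ℝ} (hf : ConvexOn ℝ univ f) (x p : ℝ) :
    IsMinOn (fun u => (x - u) ^ 2 / 2 + f u) univ p ↔ p = prox f x := by
  have hcont : Continuous f := by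
    rw [← continuousOn_univ]
    exact hf.continuousOn isOpen_univ
  have hex : ∃ q, IsMinOn (fun u => (x - u) ^ 2 / 2 + f u) univ q := by
    -- outside a compact interval around `x`, the chord inequality bounds `f` from below
    obtain ⟨M, hM⟩ := (isCompact_Icc (a := x - 1) (b := x + 1)).exists_bound_of_continuousOn
      hcont.continuousOn
    have hM' : ∀ u, |u - x| ≤ 1 → |f u| ≤ M := fun u hu => by
      have h := abs_le.1 hu
      exact hM u ⟨by linarith [h.1], by linarith [h.2]⟩
    have h0 := abs_le.1 (hM' x (by simp))
    have hlow : ∀ u, -2 * M * |u - x| - 2 * M ≤ f u := by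
      intro u
      have hM0 : 0 ≤ M := (abs_nonneg _).trans (hM' x (by simp))
      by_cases hu : |u - x| ≤ 1
      · have := abs_le.1 (hM' u hu)
        nlinarith [abs_nonneg (u - x)]
      · push Not at hu
        set r := |u - x| with hr
        have hrp : 0 < r := by linarith
        -- `w` lies at distance one from `x`, on the other side of `u`
        set w := x - (u - x) / r with hw
        have hwx : |w - x| ≤ 1 := by
          have : w - x = -((u - x) / r) := by rw [hw]; ring
          rw [this, abs_neg, abs_div, abs_of_pos hrp, ← hr, div_self hrp.ne']
        have hwM := abs_le.1 (hM' w hwx)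
        have hc := hf.2 (mem_univ u) (mem_univ w) (show (0 : ℝ) ≤ 1 / (1 + r) by positivity)
          (show (0 : ℝ) ≤ r / (1 + r) by positivity) (by field_simp)
        have hx : (1 / (1 + r)) • u + (r / (1 + r)) • w = x := by
          simp only [smul_eq_mul, hw]
          field_simp
          ring
        rw [hx] at hc
        simp only [smul_eq_mul] at hc
        have hc' : (1 + r) * f x ≤ f u + r * f w := by
          have := mul_le_mul_of_nonneg_left hc (by positivity : (0 : ℝ) ≤ 1 + r)
          have e : (1 + r) * (1 / (1 + r) * f u + r / (1 + r) * f w) = f u + r * f w := by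
            field_simp
          linarith
        nlinarith [h0.1, hwM.2]
    have hF : Continuous fun u => (x - u) ^ 2 / 2 + f u := by fun_prop
    have htend : Tendsto (fun u => (x - u) ^ 2 / 2 + f u) (cocompact ℝ) atTop := by
      have h1 : Tendsto (fun u : ℝ => |u - x|) (cocompact ℝ) atTop := by
        have := tendsto_dist_right_cocompact_atTop x
        simpa [Real.dist_eq] using this
      have h2 : Tendsto (fun r : ℝ => r * (r / 2 - 2 * M) - 2 * M) atTop atTop := by
        apply tendsto_atTop_add_const_right
        apply tendsto_id.atTop_mul_atTop₀
        apply tendsto_atTop_add_const_right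
        exact tendsto_id.atTop_div_const (by norm_num)
      refine tendsto_atTop_mono (fun u => ?_) (h2.comp h1)
      have h3 := hlow u
      have h4 : (x - u) ^ 2 = |u - x| ^ 2 := by rw [sq_abs]; ring
      simp only [Function.comp_apply]
      rw [h4]
      linarith
    obtain ⟨q, hq⟩ := hF.exists_forall_le htend
    exact ⟨q, fun u _ => hq u⟩
  have huniq : ∀ q r, IsMinOn (fun u => (x - u) ^ 2 / 2 + f u) univ q →
      IsMinOn (fun u => (x - u) ^ 2 / 2 + f u) univ r → q = r := by
    intro q r hq hr
    have h1 := hq (mem_univ ((1 / 2 : ℝ) • q + (1 / 2 : ℝ) • r))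
    have h2 := hr (mem_univ ((1 / 2 : ℝ) • q + (1 / 2 : ℝ) • r))
    have h3 := hf.2 (mem_univ q) (mem_univ r) (show (0 : ℝ) ≤ 1 / 2 by norm_num)
      (show (0 : ℝ) ≤ 1 / 2 by norm_num) (by norm_num)
    simp only [mem_ofPred_eq] at h1 h2
    simp only [smul_eq_mul] at h1 h2 h3
    have h4 : (q - r) ^ 2 ≤ 0 := by nlinarith
    have h5 : q - r = 0 := pow_eq_zero_iff two_ne_zero |>.1 (le_antisymm h4 (sq_nonneg (q - r)))
    linarith
  have hspec : IsMinOn (fun u => (x - u) ^ 2 / 2 + f u) univ (prox f x) :=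
    Classical.epsilon_spec hex
  exact ⟨fun h => huniq _ _ h hspec, fun h => h ▸ hspec⟩

section Loss

variable {𝒴 : Set ℝ} (ℓ : 𝒴 → ℝ → ℝ)

/-- The labels `y` with a coercive loss: `ℓ y u → +∞` as `|u| → +∞`. -/
def coerciveLabels : Set 𝒴 := {y | Tendsto (ℓ y) (cocompact ℝ) atTop}

/-- The labels with a strictly increasing loss. -/
def increasingLabels : Set 𝒴 := {y | StrictMono (ℓ y)}

/-- The labels with a strictly decreasing loss. -/
def decreasingLabels : Set 𝒴 := {y | StrictAnti (ℓ y)}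

variable {Ω : Type*} [MeasurableSpace Ω] (P : Measure Ω) (U G : Ω → ℝ) (Y : Ω → 𝒴)

/-- The convex function whose infimum is the inverse of the critical threshold. -/
def phi (t : ℝ) : ℝ :=
  (∫ ω, (Y ⁻¹' coerciveLabels ℓ).indicator (fun ω => (G ω + U ω * t) ^ 2) ω ∂P)
    + (∫ ω, (Y ⁻¹' increasingLabels ℓ).indicator (fun ω => max (G ω + U ω * t) 0 ^ 2) ω ∂P)
    + ∫ ω, (Y ⁻¹' decreasingLabels ℓ).indicator (fun ω => max (-(G ω + U ω * t)) 0 ^ 2) ω ∂P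

/-- The critical threshold `δ_∞ ∈ (0, +∞]`, defined by `1 / δ_∞ = inf_t φ(t)`, with the
convention `δ_∞ = +∞` if the infimum is `0`. -/
def criticalThreshold : ENNReal := (ENNReal.ofReal (⨅ t : ℝ, phi ℓ P U G Y t))⁻¹

/-- The random variable `prox[γ ℓ_Y](a U + σ G)`. -/
def proxVar (γ a σ : ℝ) (ω : Ω) : ℝ :=
  prox (fun u => γ * ℓ (Y ω) u) (a * U ω + σ * G ω)

/-- The random variable `ℓ_Y'(prox[γ ℓ_Y](a U + σ G))`. -/
def scoreVar (γ a σ : ℝ) (ω : Ω) : ℝ :=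
  deriv (ℓ (Y ω)) (proxVar ℓ U G Y γ a σ ω)

/-- `(γ, a, σ) ∈ ℝ_{>0} × ℝ × ℝ_{>0}` solves the nonlinear system with parameter `δ`. -/
structure IsSystemSolution (δ γ a σ : ℝ) : Prop where
  gamma_pos : 0 < γ
  sigma_pos : 0 < σ
  eq_one : (γ ^ 2)⁻¹ * δ⁻¹ * σ ^ 2 = ∫ ω, scoreVar ℓ U G Y γ a σ ω ^ 2 ∂P
  eq_two : 0 = ∫ ω, U ω * scoreVar ℓ U G Y γ a σ ω ∂P
  eq_three : σ * (1 - δ⁻¹) = ∫ ω, G ω * proxVar ℓ U G Y γ a σ ω ∂P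

end Loss

end

/-! ### Strictly convex functions of one variable and their proximal maps. -/

section ScalarConvex

variable {f : ℝ → ℝ}

/-! In `L²(P)` the variables `U` and `G` are orthonormal. Put c = δ^(-1/2) and let C be the cone
`ballCone` of all d with ‖tU + τG - d‖ ≤ cτ for some real t and some τ ≥ 0. The system is the
first-order condition for minimizing E[ℓ_Y(q)] over q in C. Indeed, for q = prox[γℓ_Y](aU + σG) the
residual r = aU + σG - q equals γℓ_Y'(q), and the three equations read ‖r‖ = cσ, ⟨U, r⟩ = 0, ⟨G, r⟩
= c²σ. Then q lies in C, r pairs nonnegatively with C (`inner_nonneg_of_mem_ballCone`), and r is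
orthogonal to q (`integral_score_mul_prox`).

The number φ(t) is the squared distance from tU + G to the recession cone, made of the directions
along which ℓ_Y does not increase (`phi_eq`). If φ(t) ≤ c² for some t, the projection d of tU + G
onto that cone lies in C. At a solution E[ℓ_Y'(q)d] ≥ 0 by duality, while the integrand is
nonpositive, so it vanishes almost surely. This forces d = 0 and φ(t) = 1 + t² > c², a contradiction
(`not_isSystemSolution`).

Uniqueness is monotonicity of the derivative: for two solutions duality gives E[(s - s')(q - q')] ≤
0 for the scores s, s', hence q = q' almost surely (`proxVar_ae_eq`), and q determines a, σ and γ.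

For existence when inf φ > c², a sequence in C of bounded risk and unbounded norm would, after
normalization, produce a nonzero tU + τG within cτ of the recession cone, which the threshold
excludes (`exists_norm_le_of_excessRisk_le`). So a minimizer exists. It is not a multiple of `U`, by
independence of `G` from (U, Y) (`inner_G_pos_of_minimizer`), hence C is given near it by a single
smooth inequality. The Lagrange rule then makes the score a multiple k of the residual. The score
cannot vanish almost surely, since the loss is not almost surely coercive; so k > 0, the inequality
is active, and γ = 1/k solves the system. -/

theorem ConvexOn.tangent_le (hf : ConvexOn ℝ univ f) (hd : Differentiable ℝ f) (q u : ℝ) :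
    f q + deriv f q * (u - q) ≤ f u := by
  rcases lt_trichotomy q u with h | h | h
  · have := hf.deriv_le_slope (mem_univ q) (mem_univ u) h (hd q)
    rw [slope_def_field, le_div_iff₀ (by linarith)] at this
    linarith
  · simp [h]
  · have := hf.slope_le_deriv (mem_univ u) (mem_univ q) h (hd q)
    rw [slope_def_field, div_le_iff₀ (by linarith)] at this
    linarith

theorem StrictConvexOn.strictMono_deriv (hf : StrictConvexOn ℝ univ f)
    (hd : Differentiable ℝ f) : StrictMono (deriv f) :=
  strictMonoOn_univ.1 (hf.strictMonoOn_deriv fun x _ => hd x)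

theorem StrictConvexOn.deriv_pos_of_strictMono (hf : StrictConvexOn ℝ univ f)
    (hd : Differentiable ℝ f) (hm : StrictMono f) (x : ℝ) : 0 < deriv f x :=
  lt_of_le_of_lt hm.monotone.deriv_nonneg (hf.strictMono_deriv hd (sub_one_lt x))

theorem StrictConvexOn.deriv_neg_of_strictAnti (hf : StrictConvexOn ℝ univ f)
    (hd : Differentiable ℝ f) (hm : StrictAnti f) (x : ℝ) : deriv f x < 0 :=
  lt_of_lt_of_le (hf.strictMono_deriv hd (lt_add_one x)) hm.antitone.deriv_nonpos

/-- One step further out the derivatives are strictly signed, and the tangents at `p - 1` and `q +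
1` bound `f` from below at the two ends. -/
theorem StrictConvexOn.coercive_of_deriv (hf : StrictConvexOn ℝ univ f)
    (hd : Differentiable ℝ f) {p q : ℝ} (hp : deriv f p ≤ 0) (hq : 0 ≤ deriv f q) :
    Tendsto f (cocompact ℝ) atTop := by
  have hmono := hf.strictMono_deriv hd
  have h1 : 0 < deriv f (q + 1) := lt_of_le_of_lt hq (hmono (lt_add_one q))
  have h2 : deriv f (p - 1) < 0 := lt_of_lt_of_le (hmono (sub_one_lt p)) hp
  rw [cocompact_eq_atBot_atTop, tendsto_sup]
  constructor
  · refine tendsto_atTop_mono (hf.convexOn.tangent_le hd (p - 1)) ?_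
    apply tendsto_atTop_add_const_left
    apply Tendsto.const_mul_atBot_of_neg h2
    exact tendsto_atBot_add_const_right _ _ tendsto_id
  · refine tendsto_atTop_mono (hf.convexOn.tangent_le hd (q + 1)) ?_
    apply tendsto_atTop_add_const_left
    apply Tendsto.const_mul_atTop h1
    exact tendsto_atTop_add_const_right _ _ tendsto_id

theorem StrictConvexOn.coercive_or_strictMono_or_strictAnti (hf : StrictConvexOn ℝ univ f)
    (hd : Differentiable ℝ f) :
    Tendsto f (cocompact ℝ) atTop ∨ StrictMono f ∨ StrictAnti f := by
  by_cases h1 : ∀ x, 0 < deriv f x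
  · exact Or.inr (Or.inl (strictMono_of_deriv_pos h1))
  by_cases h2 : ∀ x, deriv f x < 0
  · exact Or.inr (Or.inr (strictAnti_of_deriv_neg h2))
  push Not at h1 h2
  obtain ⟨p, hp⟩ := h1
  obtain ⟨q, hq⟩ := h2
  exact Or.inl (hf.coercive_of_deriv hd hp hq)

theorem StrictMono.not_tendsto_cocompact_atTop (hm : StrictMono f) :
    ¬ Tendsto f (cocompact ℝ) atTop := by
  rw [cocompact_eq_atBot_atTop, tendsto_sup]
  rintro ⟨h, -⟩
  obtain ⟨x, hx, hx0⟩ := ((h.eventually_gt_atTop (f 0)).and (eventually_le_atBot 0)).exists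
  exact absurd (hm.monotone hx0) (not_le.2 hx)

theorem StrictAnti.not_tendsto_cocompact_atTop (hm : StrictAnti f) :
    ¬ Tendsto f (cocompact ℝ) atTop := by
  rw [cocompact_eq_atBot_atTop, tendsto_sup]
  rintro ⟨-, h⟩
  obtain ⟨x, hx, hx0⟩ := ((h.eventually_gt_atTop (f 0)).and (eventually_ge_atTop 0)).exists
  exact absurd (hm.antitone hx0) (not_le.2 hx)

/-- Fermat's rule gives one direction. Conversely, adding the tangent inequality to the expansion of
the square leaves a remainder (u - q)²/2. -/
theorem ConvexOn.eq_prox_iff (hf : ConvexOn ℝ univ f) (hd : Differentiable ℝ f) {γ : ℝ}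
    (hγ : 0 < γ) (x q : ℝ) :
    q = prox (fun u => γ * f u) x ↔ x - q = γ * deriv f q := by
  have hγf : ConvexOn ℝ univ fun u => γ * f u := by
    simpa [smul_eq_mul] using hf.smul hγ.le
  rw [← isMinOn_iff_eq_prox hγf]
  constructor
  · intro h
    have hloc : IsLocalMin (fun u => (x - u) ^ 2 / 2 + γ * f u) q :=
      h.isLocalMin univ_mem
    have hder : HasDerivAt (fun u => (x - u) ^ 2 / 2 + γ * f u)
        (-(x - q) + γ * deriv f q) q := by
      have h1 : HasDerivAt (fun u => (x - u) ^ 2 / 2) (-(x - q)) q := by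
        refine ((((hasDerivAt_id' q).const_sub x).pow 2).div_const 2).congr_deriv ?_
        ring
      exact h1.add ((hd q).hasDerivAt.const_mul γ)
    have := hloc.hasDerivAt_eq_zero hder
    linarith
  · intro h u _
    have h1 := hf.tangent_le hd q u
    have h2 := mul_le_mul_of_nonneg_left h1 hγ.le
    change (x - q) ^ 2 / 2 + γ * f q ≤ (x - u) ^ 2 / 2 + γ * f u
    have h3 : γ * (f q + deriv f q * (u - q)) = γ * f q + (x - q) * (u - q) := by
      rw [h]; ring
    nlinarith [sq_nonneg (u - q)]

theorem ConvexOn.prox_spec (hf : ConvexOn ℝ univ f) (hd : Differentiable ℝ f) {γ : ℝ}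
    (hγ : 0 < γ) (x : ℝ) :
    x - prox (fun u => γ * f u) x = γ * deriv f (prox (fun u => γ * f u) x) :=
  (hf.eq_prox_iff hd hγ x _).1 rfl

/-- The proximal map inverts the strictly increasing map c ↦ c + γ f' c. In this form its
measurability in the label reduces to that of the derivative at a fixed point. -/
theorem StrictConvexOn.prox_le_iff (hf : StrictConvexOn ℝ univ f) (hd : Differentiable ℝ f)
    {γ : ℝ} (hγ : 0 < γ) (x c : ℝ) :
    prox (fun u => γ * f u) x ≤ c ↔ x ≤ c + γ * deriv f c := by
  have hs := hf.convexOn.prox_spec hd hγ x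
  set p := prox (fun u => γ * f u) x
  have hmono := (hf.strictMono_deriv hd)
  constructor
  · intro h
    have := mul_le_mul_of_nonneg_left (hmono.monotone h) hγ.le
    linarith
  · intro h
    by_contra! hc
    have := mul_lt_mul_of_pos_left (hmono hc) hγ
    linarith

end ScalarConvex

/-! ### Distance to the recession cone, label by label, and measurability. -/

section Labels

variable {𝒴 : Set ℝ} {ℓ : 𝒴 → ℝ → ℝ}

open Classical in
/-- The signed distance from `x` to the cone of directions in which `ℓ y` is bounded above. -/
noncomputable def excess (ℓ : 𝒴 → ℝ → ℝ) (y : 𝒴) (x : ℝ) : ℝ :=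
  if y ∈ coerciveLabels ℓ then x else if y ∈ increasingLabels ℓ then max x 0 else min x 0

theorem excess_of_coercive {y : 𝒴} (h : y ∈ coerciveLabels ℓ) (x : ℝ) : excess ℓ y x = x :=
  if_pos h

theorem excess_of_increasing {y : 𝒴} (h : y ∈ increasingLabels ℓ) (x : ℝ) :
    excess ℓ y x = max x 0 := by
  have h' : y ∉ coerciveLabels ℓ := StrictMono.not_tendsto_cocompact_atTop h
  rw [excess, if_neg h', if_pos h]

theorem decreasing_notMem {y : 𝒴} (h : y ∈ decreasingLabels ℓ) :
    y ∉ coerciveLabels ℓ ∧ y ∉ increasingLabels ℓ :=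
  ⟨StrictAnti.not_tendsto_cocompact_atTop h, fun h' =>
    absurd (StrictMono.lt_iff_lt h' |>.2 (zero_lt_one (α := ℝ)))
      (not_lt.2 (StrictAnti.antitone h zero_le_one))⟩

theorem excess_of_decreasing {y : 𝒴} (h : y ∈ decreasingLabels ℓ) (x : ℝ) :
    excess ℓ y x = min x 0 := by
  rw [excess, if_neg (decreasing_notMem h).1, if_neg (decreasing_notMem h).2]

theorem abs_excess_le (y : 𝒴) (x : ℝ) : |excess ℓ y x| ≤ |x| := by
  unfold excess
  split_ifs
  · exact le_rfl
  · rcases max_cases x 0 with h | h <;> simp [h.1]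
  · rcases min_cases x 0 with h | h <;> simp [h.1]

theorem abs_excess_sub_excess_le (y : 𝒴) (x x' : ℝ) :
    |excess ℓ y x - excess ℓ y x'| ≤ |x - x'| := by
  unfold excess
  split_ifs
  · exact le_rfl
  · exact abs_max_sub_max_le_abs x x' 0
  · simpa using abs_min_sub_min_le_max x 0 x' 0

theorem excess_mul {c : ℝ} (hc : 0 ≤ c) (y : 𝒴) (x : ℝ) :
    excess ℓ y (c * x) = c * excess ℓ y x := by
  unfold excess
  split_ifs
  · rfl
  · rw [← mul_zero c, ← mul_max_of_nonneg _ _ hc, mul_zero]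
  · rw [← mul_zero c, ← mul_min_of_nonneg _ _ hc, mul_zero]

theorem continuous_excess (y : 𝒴) : Continuous (excess ℓ y) := by
  unfold excess
  split_ifs <;> fun_prop

variable (hsm : ∀ y, ContDiff ℝ 1 (ℓ y)) (hcv : ∀ y, StrictConvexOn ℝ univ (ℓ y))
  (hme : ∀ u : ℝ, Measurable fun y : 𝒴 => ℓ y u)
include hsm

theorem differentiable_loss (y : 𝒴) : Differentiable ℝ (ℓ y) :=
  (hsm y).differentiable (by norm_num)

theorem continuous_deriv_loss (y : 𝒴) : Continuous (deriv (ℓ y)) :=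
  (hsm y).continuous_deriv le_rfl

include hcv in
theorem label_trichotomy (y : 𝒴) :
    y ∈ coerciveLabels ℓ ∨ y ∈ increasingLabels ℓ ∨ y ∈ decreasingLabels ℓ :=
  (hcv y).coercive_or_strictMono_or_strictAnti (differentiable_loss hsm y)

include hcv in
/-- Moving along `x - excess ℓ y x` does not increase the loss to first order. -/
theorem deriv_mul_sub_excess (y : 𝒴) (q x : ℝ) :
    deriv (ℓ y) q * (x - excess ℓ y x) ≤ 0 ∧
      (deriv (ℓ y) q * (x - excess ℓ y x) = 0 → excess ℓ y x = x) := by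
  have hd := differentiable_loss hsm y
  rcases label_trichotomy hsm hcv y with h | h | h
  · simp [excess_of_coercive h]
  · have hp := (hcv y).deriv_pos_of_strictMono hd h q
    rw [excess_of_increasing h]
    have : x - max x 0 ≤ 0 := by simp
    refine ⟨mul_nonpos_of_nonneg_of_nonpos hp.le this, fun h0 => ?_⟩
    rcases mul_eq_zero.1 h0 with h0 | h0
    · exact absurd h0 hp.ne'
    · linarith
  · have hp := (hcv y).deriv_neg_of_strictAnti hd h q
    rw [excess_of_decreasing h]
    have : 0 ≤ x - min x 0 := by simp
    refine ⟨mul_nonpos_of_nonpos_of_nonneg hp.le this, fun h0 => ?_⟩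
    rcases mul_eq_zero.1 h0 with h0 | h0
    · exact absurd h0 hp.ne
    · linarith

include hme in
theorem measurable_deriv_loss (u : ℝ) : Measurable fun y : 𝒴 => deriv (ℓ y) u := by
  -- The derivative is a limit of difference quotients along the steps 1/(n+1).
  refine measurable_of_tendsto_metrizable
    (f := fun (n : ℕ) y => ((n : ℝ) + 1) * (ℓ y (u + ((n : ℝ) + 1)⁻¹) - ℓ y u)) (fun n => ?_) ?_
  · exact ((hme _).sub (hme _)).const_mul _
  · rw [tendsto_pi_nhds]
    intro y
    have h := (differentiable_loss hsm y u).hasDerivAt.tendsto_slope_zero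
    have h2 : Tendsto (fun n : ℕ => ((n : ℝ) + 1)⁻¹) atTop (nhdsWithin 0 {0}ᶜ) := by
      rw [tendsto_nhdsWithin_iff]
      refine ⟨?_, Eventually.of_forall fun n => ?_⟩
      · simpa using tendsto_one_div_add_atTop_nhds_zero_nat (𝕜 := ℝ)
      · simp only [mem_compl_iff, mem_singleton_iff]
        positivity
    refine (h.comp h2).congr fun n => ?_
    simp

include hcv hme

theorem measurableSet_increasingLabels : MeasurableSet (increasingLabels ℓ) := by
  -- The derivative is increasing, so its positivity needs testing only along a sequence tending to
  -- -∞.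
  have : increasingLabels ℓ = ⋂ n : ℕ, {y | 0 < deriv (ℓ y) (-n)} := by
    ext y
    simp only [mem_iInter, mem_ofPred_eq]
    have hd := differentiable_loss hsm y
    refine ⟨fun h n => (hcv y).deriv_pos_of_strictMono hd h _, fun h => ?_⟩
    refine strictMono_of_deriv_pos fun x => ?_
    obtain ⟨n, hn⟩ := exists_nat_ge (-x)
    exact (h n).trans_le (((hcv y).strictMono_deriv hd).monotone (by linarith))
  rw [this]
  exact MeasurableSet.iInter fun n =>
    measurableSet_lt measurable_const (measurable_deriv_loss hsm hme _)

theorem measurableSet_decreasingLabels : MeasurableSet (decreasingLabels ℓ) := by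
  have : decreasingLabels ℓ = ⋂ n : ℕ, {y | deriv (ℓ y) n < 0} := by
    ext y
    simp only [mem_iInter, mem_ofPred_eq]
    have hd := differentiable_loss hsm y
    refine ⟨fun h n => (hcv y).deriv_neg_of_strictAnti hd h _, fun h => ?_⟩
    refine strictAnti_of_deriv_neg fun x => ?_
    obtain ⟨n, hn⟩ := exists_nat_ge x
    exact (((hcv y).strictMono_deriv hd).monotone hn).trans_lt (h n)
  rw [this]
  exact MeasurableSet.iInter fun n =>
    measurableSet_lt (measurable_deriv_loss hsm hme _) measurable_const

theorem measurableSet_coerciveLabels : MeasurableSet (coerciveLabels ℓ) := by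
  have : coerciveLabels ℓ = (increasingLabels ℓ ∪ decreasingLabels ℓ)ᶜ := by
    ext y
    simp only [mem_compl_iff, mem_union, not_or]
    refine ⟨fun h => ⟨fun h' => StrictMono.not_tendsto_cocompact_atTop h' h,
      fun h' => (decreasing_notMem h').1 h⟩, fun h => ?_⟩
    rcases label_trichotomy hsm hcv y with h' | h' | h'
    · exact h'
    · exact absurd h' h.1
    · exact absurd h' h.2
  rw [this]
  exact ((measurableSet_increasingLabels hsm hcv hme).union
    (measurableSet_decreasingLabels hsm hcv hme)).compl

theorem measurable_excess : Measurable fun p : 𝒴 × ℝ => excess ℓ p.1 p.2 := by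
  unfold excess
  refine Measurable.ite (measurable_fst (measurableSet_coerciveLabels hsm hcv hme))
    measurable_snd (Measurable.ite (measurable_fst (measurableSet_increasingLabels hsm hcv hme))
      ?_ ?_) <;> fun_prop

omit hcv in
theorem measurable_loss_uncurry : Measurable fun p : 𝒴 × ℝ => ℓ p.1 p.2 := by
  have := measurable_uncurry_of_continuous_of_measurable (u := fun (u : ℝ) (y : 𝒴) => ℓ y u)
    (fun y => (differentiable_loss hsm y).continuous) hme
  exact this.comp measurable_swap

omit hcv in
theorem measurable_deriv_loss_uncurry : Measurable fun p : 𝒴 × ℝ => deriv (ℓ p.1) p.2 := by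
  have := measurable_uncurry_of_continuous_of_measurable
    (u := fun (u : ℝ) (y : 𝒴) => deriv (ℓ y) u)
    (fun y => continuous_deriv_loss hsm y) (measurable_deriv_loss hsm hme)
  exact this.comp measurable_swap

end Labels

/-! ### Minimization over convex sets and the cone around a half-plane in a Hilbert space. -/

section Hilbert

variable {H : Type*} [NormedAddCommGroup H] [InnerProductSpace ℝ H]

/-- Decreasing nonempty closed convex sets in a Hilbert space, the first of them bounded, have a
common point. -/
theorem nonempty_iInter_of_closed_convex_bounded [CompleteSpace H] {C : ℕ → Set H}
    (hanti : Antitone C) (hne : ∀ n, (C n).Nonempty) (hcl : ∀ n, IsClosed (C n))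
    (hcv : ∀ n, Convex ℝ (C n)) {R : ℝ} (hR : ∀ x ∈ C 0, ‖x‖ ≤ R) : (⋂ n, C n).Nonempty := by
  -- The points of minimal norm have increasing bounded norms; they form a Cauchy sequence whose
  -- limit is the common point.
  choose p hpC hp using fun n =>
    exists_norm_eq_iInf_of_complete_convex (hne n) (hcl n).isComplete (hcv n) (0 : H)
  have hmin : ∀ n, ∀ x ∈ C n, ‖p n‖ ≤ ‖x‖ := by
    intro n x hx
    have h1 : ‖p n‖ = ⨅ w : C n, ‖(0 : H) - w‖ := by rw [← hp n]; simp
    rw [h1]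
    have hb : BddBelow (range fun w : C n => ‖(0 : H) - w‖) :=
      ⟨0, by rintro _ ⟨w, rfl⟩; exact norm_nonneg _⟩
    simpa using ciInf_le hb ⟨x, hx⟩
  have hmono : Monotone fun n => ‖p n‖ ^ 2 := fun m n hmn =>
    pow_le_pow_left₀ (norm_nonneg _) (hmin m _ (hanti hmn (hpC n))) 2
  have hbdd : BddAbove (range fun n => ‖p n‖ ^ 2) := by
    refine ⟨R ^ 2, ?_⟩
    rintro _ ⟨n, rfl⟩
    exact pow_le_pow_left₀ (norm_nonneg _) (hR _ (hanti (Nat.zero_le n) (hpC n))) 2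
  have hlim := tendsto_atTop_ciSup hmono hbdd
  set L := ⨆ n, ‖p n‖ ^ 2 with hL
  have hLle : ∀ n, ‖p n‖ ^ 2 ≤ L := fun n => le_ciSup hbdd n
  -- The midpoint of `p m` and `p n` lies in `C m`, so its norm is at least ‖p m‖; the parallelogram
  -- law turns this into a distance bound.
  have hdist : ∀ m n, m ≤ n → ‖p n - p m‖ ^ 2 ≤ 2 * (L - ‖p m‖ ^ 2) := by
    intro m n hmn
    have hmid : (1 / 2 : ℝ) • p m + (1 / 2 : ℝ) • p n ∈ C m :=
      hcv m (hpC m) (hanti hmn (hpC n)) (by norm_num) (by norm_num) (by norm_num)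
    have h1 := hmin m _ hmid
    rw [← smul_add, norm_smul, Real.norm_of_nonneg (by norm_num)] at h1
    have h2 := parallelogram_law_with_norm ℝ (p n) (p m)
    have h3 : (2 * ‖p m‖) ^ 2 ≤ ‖p m + p n‖ ^ 2 :=
      pow_le_pow_left₀ (by positivity) (by linarith) 2
    rw [add_comm (p m)] at h3
    have := hLle n
    nlinarith
  have hcauchy : CauchySeq p := by
    rw [Metric.cauchySeq_iff']
    intro ε hε
    have : ∀ᶠ m in atTop, 2 * (L - ‖p m‖ ^ 2) < ε ^ 2 := by
      have h : Tendsto (fun m => 2 * (L - ‖p m‖ ^ 2)) atTop (nhds (2 * (L - L))) :=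
        (hlim.const_sub L).const_mul 2
      rw [sub_self, mul_zero] at h
      exact h.eventually_lt_const (by positivity)
    obtain ⟨m, hm⟩ := this.exists
    refine ⟨m, fun n hn => ?_⟩
    rw [dist_eq_norm]
    exact lt_of_pow_lt_pow_left₀ 2 hε.le ((hdist m n hn).trans_lt hm)
  obtain ⟨x, hx⟩ := cauchySeq_tendsto_of_complete hcauchy
  refine ⟨x, mem_iInter.2 fun n => (hcl n).mem_of_tendsto hx ?_⟩
  filter_upwards [eventually_ge_atTop n] with m hm using hanti hm (hpC m)

/-- A function with closed convex sublevel sets, one of them nonempty and bounded, attains its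
minimum. -/
theorem exists_forall_le_of_bounded_sublevel [CompleteSpace H] {C : Set H}
    {F : H → ENNReal} (hcl : ∀ c, IsClosed {x ∈ C | F x ≤ c})
    (hcv : ∀ c, Convex ℝ {x ∈ C | F x ≤ c}) {x₀ : H} (hx₀ : x₀ ∈ C) {R : ℝ}
    (hR : ∀ x ∈ C, F x ≤ F x₀ → ‖x‖ ≤ R) : ∃ x ∈ C, ∀ y ∈ C, F x ≤ F y := by
  -- Levels `v n` decreasing to the infimum give nested sublevel sets; a common point attains the
  -- infimum.
  obtain ⟨v, hv, hvlim, hvmem⟩ := exists_seq_tendsto_sInf (S := F '' {x ∈ C | F x ≤ F x₀})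
    ⟨F x₀, x₀, ⟨hx₀, le_rfl⟩, rfl⟩ (OrderBot.bddBelow _)
  obtain ⟨x, hx⟩ := nonempty_iInter_of_closed_convex_bounded (C := fun n => {x ∈ C | F x ≤ v n})
    (fun m n hmn x hx => ⟨hx.1, hx.2.trans (hv hmn)⟩)
    (fun n => by
      obtain ⟨x, hx, hxv⟩ := hvmem n
      exact ⟨x, hx.1, hxv.le⟩)
    (fun n => hcl _) (fun n => hcv _) (R := R)
    (fun x hx => hR x hx.1 (hx.2.trans (by
      obtain ⟨z, hz, hzv⟩ := hvmem 0
      exact hzv ▸ hz.2)))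
  rw [mem_iInter] at hx
  have hxinf : F x ≤ sInf (F '' {x ∈ C | F x ≤ F x₀}) := ge_of_tendsto' hvlim fun n => (hx n).2
  refine ⟨x, (hx 0).1, fun y hy => ?_⟩
  rcases le_total (F y) (F x₀) with h | h
  · exact hxinf.trans (sInf_le ⟨y, ⟨hy, h⟩, rfl⟩)
  · exact (hxinf.trans (sInf_le ⟨x₀, ⟨hx₀, le_rfl⟩, rfl⟩)).trans h

open scoped RealInnerProductSpace

/-- The cone generated, modulo the line `ℝ u`, by the ball of radius `c` around `g`. -/
def ballCone (u g : H) (c : ℝ) : Set H := {d | ∃ t τ : ℝ, 0 ≤ τ ∧ ‖t • u + τ • g - d‖ ≤ c * τ}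

variable {u g : H} {c : ℝ}

theorem convex_ballCone : Convex ℝ (ballCone u g c) := by
  rintro x ⟨t, τ, hτ, h⟩ y ⟨t', τ', hτ', h'⟩ p q hp hq -
  refine ⟨p * t + q * t', p * τ + q * τ', by positivity, ?_⟩
  have : (p * t + q * t') • u + (p * τ + q * τ') • g - (p • x + q • y)
      = p • (t • u + τ • g - x) + q • (t' • u + τ' • g - y) := by
    module
  rw [this]
  refine (norm_add_le _ _).trans ?_
  rw [norm_smul, norm_smul, Real.norm_of_nonneg hp, Real.norm_of_nonneg hq]
  nlinarith [mul_le_mul_of_nonneg_left h hp, mul_le_mul_of_nonneg_left h' hq]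

theorem norm_sq_comb_sub (hu : ‖u‖ = 1) (hg : ‖g‖ = 1) (hug : ⟪u, g⟫ = 0) (t τ : ℝ) (d : H) :
    ‖t • u + τ • g - d‖ ^ 2 = t ^ 2 + τ ^ 2 - 2 * t * ⟪u, d⟫ - 2 * τ * ⟪g, d⟫ + ‖d‖ ^ 2 := by
  rw [norm_sub_sq_real, norm_add_sq_real, norm_smul, norm_smul, hu, hg, inner_add_left,
    inner_smul_left, inner_smul_left, inner_smul_left, inner_smul_right, hug]
  simp only [conj_trivial, mul_one, Real.norm_eq_abs, sq_abs, mul_zero, add_zero]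
  ring

/-- Eliminating the two parameters: the squared constraint is quadratic in (t, τ), with optimum t =
⟪u, d⟫ and τ = ⟪g, d⟫ / (1 - c²). This exhibits the cone as closed and gives it one smooth
constraint inside a half space. -/
theorem mem_ballCone_iff (hu : ‖u‖ = 1) (hg : ‖g‖ = 1) (hug : ⟪u, g⟫ = 0) (hc : 0 < c)
    (hc1 : c < 1) {d : H} :
    d ∈ ballCone u g c ↔
      0 ≤ ⟪g, d⟫ ∧ ‖d‖ ^ 2 - ⟪u, d⟫ ^ 2 - ⟪g, d⟫ ^ 2 / (1 - c ^ 2) ≤ 0 := by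
  have hk : 0 < 1 - c ^ 2 := by nlinarith
  constructor
  · rintro ⟨t, τ, hτ, h⟩
    have h1 : ‖t • u + τ • g - d‖ ^ 2 ≤ (c * τ) ^ 2 := pow_le_pow_left₀ (norm_nonneg _) h 2
    rw [norm_sq_comb_sub hu hg hug] at h1
    have h2 : ‖d‖ ^ 2 - ⟪u, d⟫ ^ 2 - ⟪g, d⟫ ^ 2 / (1 - c ^ 2) ≤ 0 := by
      have e : ⟪g, d⟫ ^ 2 / (1 - c ^ 2) =
          2 * τ * ⟪g, d⟫ - (1 - c ^ 2) * τ ^ 2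
            + (⟪g, d⟫ - (1 - c ^ 2) * τ) ^ 2 / (1 - c ^ 2) := by
        field_simp
        ring
      have : 0 ≤ (⟪g, d⟫ - (1 - c ^ 2) * τ) ^ 2 / (1 - c ^ 2) := by positivity
      nlinarith [sq_nonneg (t - ⟪u, d⟫)]
    refine ⟨?_, h2⟩
    have h3 : ⟪u, d⟫ ^ 2 ≤ ‖d‖ ^ 2 := by
      have := abs_real_inner_le_norm u d
      rw [hu, one_mul] at this
      exact sq_le_sq' (by linarith [(abs_le.1 this).1]) (abs_le.1 this).2
    have h4 : (1 - c ^ 2) * τ ^ 2 ≤ 2 * τ * ⟪g, d⟫ := by nlinarith [sq_nonneg (t - ⟪u, d⟫)]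
    -- For τ = 0 the inequality above says nothing about the sign of ⟪g, d⟫, but then d = t • u.
    rcases hτ.eq_or_lt with h0 | h0
    · subst h0
      have h5 : t • u + (0 : ℝ) • g - d = 0 := by
        rw [← norm_le_zero_iff]
        simpa using h
      have h6 : d = t • u := by
        have := sub_eq_zero.1 h5
        simpa using this.symm
      rw [h6, inner_smul_right, real_inner_comm, hug]
      simp
    · by_contra! hneg
      have : 0 < (1 - c ^ 2) * τ ^ 2 := by positivity
      nlinarith
  · rintro ⟨h1, h2⟩
    refine ⟨⟪u, d⟫, ⟪g, d⟫ / (1 - c ^ 2), by positivity, ?_⟩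
    refine le_of_sq_le_sq ?_ (by positivity)
    rw [norm_sq_comb_sub hu hg hug]
    have : ⟪g, d⟫ = (1 - c ^ 2) * (⟪g, d⟫ / (1 - c ^ 2)) := by field_simp
    have e2 : ⟪g, d⟫ ^ 2 / (1 - c ^ 2) = (1 - c ^ 2) * (⟪g, d⟫ / (1 - c ^ 2)) ^ 2 := by
      field_simp
    rw [e2] at h2
    set τ := ⟪g, d⟫ / (1 - c ^ 2)
    rw [this]
    nlinarith

theorem isClosed_ballCone (hu : ‖u‖ = 1) (hg : ‖g‖ = 1) (hug : ⟪u, g⟫ = 0) (hc : 0 < c)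
    (hc1 : c < 1) : IsClosed (ballCone u g c) := by
  have : ballCone u g c = {d | 0 ≤ ⟪g, d⟫} ∩
      {d | ‖d‖ ^ 2 - ⟪u, d⟫ ^ 2 - ⟪g, d⟫ ^ 2 / (1 - c ^ 2) ≤ 0} := by
    ext d
    exact mem_ballCone_iff hu hg hug hc hc1
  rw [this]
  exact (isClosed_le continuous_const (by fun_prop)).inter
    (isClosed_le (by fun_prop) continuous_const)

/-- The pairing of `r` with tu + τg is σc²τ, and Cauchy–Schwarz bounds its pairing with the
deviation from `d` by cσ · cτ, the same number. The hypotheses on `r` are the three equations of the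
system. -/
theorem inner_nonneg_of_mem_ballCone (hc : 0 ≤ c) {r d : H} {σ : ℝ} (hσ : 0 ≤ σ)
    (hur : ⟪u, r⟫ = 0) (hgr : ⟪g, r⟫ = σ * c ^ 2) (hr : ‖r‖ = c * σ)
    (hd : d ∈ ballCone u g c) : 0 ≤ ⟪r, d⟫ := by
  obtain ⟨t, τ, hτ, h⟩ := hd
  have h1 := real_inner_le_norm r (t • u + τ • g - d)
  rw [inner_sub_right, inner_add_right, inner_smul_right, inner_smul_right, real_inner_comm,
    hur, real_inner_comm, hgr, hr] at h1
  have h2 : c * σ * ‖t • u + τ • g - d‖ ≤ c * σ * (c * τ) :=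
    mul_le_mul_of_nonneg_left h (by positivity)
  nlinarith

end Hilbert

/-! ### Square-integrable functions as vectors of `L²`. -/

section L2

variable {Ω : Type*} [MeasurableSpace Ω] {P : Measure Ω}

open scoped RealInnerProductSpace

theorem inner_toLp_eq_integral {f h : Ω → ℝ} (hf : MemLp f 2 P) (hh : MemLp h 2 P) :
    ⟪hf.toLp f, hh.toLp h⟫ = ∫ ω, f ω * h ω ∂P := by
  rw [L2.inner_def]
  refine integral_congr_ae ?_
  filter_upwards [hf.coeFn_toLp, hh.coeFn_toLp] with ω h1 h2
  rw [h1, h2]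
  simp [mul_comm]

theorem norm_toLp_sq_eq_integral {f : Ω → ℝ} (hf : MemLp f 2 P) :
    ‖hf.toLp f‖ ^ 2 = ∫ ω, f ω ^ 2 ∂P := by
  rw [← real_inner_self_eq_norm_sq, inner_toLp_eq_integral]
  simp [sq]

theorem memLp_two_of_sq_le {f h : Ω → ℝ} (hf : AEStronglyMeasurable f P) (hh : Integrable h P)
    (hle : ∀ᵐ ω ∂P, f ω ^ 2 ≤ h ω) : MemLp f 2 P := by
  rw [memLp_two_iff_integrable_sq hf]
  refine hh.mono' (hf.pow 2) ?_
  filter_upwards [hle] with ω h1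
  rwa [Real.norm_of_nonneg (sq_nonneg _)]

end L2

/-! ### The probabilistic model and the residual form of the system. -/

/-- The standing assumptions on the loss, the labels and the Gaussian variables. -/
structure IsLossModel {Ω : Type*} [MeasurableSpace Ω] (P : Measure Ω) {𝒴 : Set ℝ}
    (ℓ : 𝒴 → ℝ → ℝ) (U G : Ω → ℝ) (Y : Ω → 𝒴) : Prop where
  measurable_U : Measurable U
  measurable_G : Measurable G
  measurable_Y : Measurable Y
  law_U : P.map U = gaussianReal 0 1
  law_G : P.map G = gaussianReal 0 1
  indep : IndepFun G (fun ω => (U ω, Y ω)) P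
  meas : ∀ u : ℝ, Measurable fun y : 𝒴 => ℓ y u
  smooth : ∀ y, ContDiff ℝ 1 (ℓ y)
  convex : ∀ y, StrictConvexOn ℝ univ (ℓ y)
  nontrivial_neg : 0 < ∫ ω, ((Y ⁻¹' coerciveLabels ℓ)
        ∪ (Y ⁻¹' decreasingLabels ℓ ∩ {ω | 0 < U ω})
        ∪ (Y ⁻¹' increasingLabels ℓ ∩ {ω | U ω < 0})).indicator (fun ω => U ω ^ 2) ω ∂P
  nontrivial_pos : 0 < ∫ ω, ((Y ⁻¹' coerciveLabels ℓ)
        ∪ (Y ⁻¹' decreasingLabels ℓ ∩ {ω | U ω < 0})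
        ∪ (Y ⁻¹' increasingLabels ℓ ∩ {ω | 0 < U ω})).indicator (fun ω => U ω ^ 2) ω ∂P
  bddBelow : ∀ᵐ ω ∂P, BddBelow (range (ℓ (Y ω)))
  integrable_inf : Integrable (fun ω => ⨅ u : ℝ, ℓ (Y ω) u) P
  integrable_gauss : Integrable (fun ω => ℓ (Y ω) (G ω)) P
  not_coercive : P (Y ⁻¹' coerciveLabels ℓ) < 1
  growth : ∃ b : ℝ, 0 < b ∧ ∃ D : Ω → ℝ, Integrable D P ∧
    ∀ᵐ ω ∂P, ∀ u : ℝ, |excess ℓ (Y ω) u| ≤ b * (ℓ (Y ω) u + D ω)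

namespace IsLossModel

variable {Ω : Type*} [MeasurableSpace Ω] {P : Measure Ω} {𝒴 : Set ℝ}
  {ℓ : 𝒴 → ℝ → ℝ} {U G : Ω → ℝ} {Y : Ω → 𝒴}

section Gaussian

theorem memLp_two_of_map_eq_gaussian {X : Ω → ℝ} (hX : Measurable X)
    (h : P.map X = gaussianReal 0 1) : MemLp X 2 P := by
  have h2 : MemLp (id : ℝ → ℝ) 2 (P.map X) := by
    rw [h]
    exact memLp_id_gaussianReal 2
  exact (memLp_map_measure_iff aestronglyMeasurable_id hX.aemeasurable).1 h2

theorem integral_eq_zero_of_map_eq_gaussian {X : Ω → ℝ} (hX : Measurable X)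
    (h : P.map X = gaussianReal 0 1) : ∫ ω, X ω ∂P = 0 := by
  have := integral_map (μ := P) hX.aemeasurable (f := fun x : ℝ => x) (by fun_prop)
  rw [← this, h, integral_id_gaussianReal]

theorem integral_sq_of_map_eq_gaussian {X : Ω → ℝ} (hX : Measurable X)
    (h : P.map X = gaussianReal 0 1) : ∫ ω, X ω ^ 2 ∂P = 1 := by
  have hv := variance_of_integral_eq_zero (μ := P) hX.aemeasurable
    (integral_eq_zero_of_map_eq_gaussian hX h)
  have := variance_map (μ := P) (Y := X) (X := id) (by fun_prop) hX.aemeasurable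
  rw [h, variance_id_gaussianReal] at this
  rw [← hv]
  simpa using this.symm

end Gaussian

variable (M : IsLossModel P ℓ U G Y)
include M

theorem memLp_U : MemLp U 2 P := memLp_two_of_map_eq_gaussian M.measurable_U M.law_U

theorem memLp_G : MemLp G 2 P := memLp_two_of_map_eq_gaussian M.measurable_G M.law_G

theorem memLp_comb (a σ : ℝ) : MemLp (fun ω => a * U ω + σ * G ω) 2 P :=
  (M.memLp_U.const_mul a).add (M.memLp_G.const_mul σ)

theorem integral_U_sq : ∫ ω, U ω ^ 2 ∂P = 1 :=
  integral_sq_of_map_eq_gaussian M.measurable_U M.law_U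

theorem integral_G_sq : ∫ ω, G ω ^ 2 ∂P = 1 :=
  integral_sq_of_map_eq_gaussian M.measurable_G M.law_G

theorem integral_U_mul_G : ∫ ω, U ω * G ω ∂P = 0 := by
  have h : IndepFun G U P := M.indep.comp measurable_id measurable_fst
  have := h.symm.integral_fun_mul_eq_mul_integral M.measurable_U.aestronglyMeasurable
    M.measurable_G.aestronglyMeasurable
  rw [this, integral_eq_zero_of_map_eq_gaussian M.measurable_U M.law_U, zero_mul]

theorem differentiable (y : 𝒴) : Differentiable ℝ (ℓ y) := differentiable_loss M.smooth y

theorem aestronglyMeasurable_loss {q : Ω → ℝ} (hq : AEStronglyMeasurable q P) :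
    AEStronglyMeasurable (fun ω => ℓ (Y ω) (q ω)) P :=
  ((measurable_loss_uncurry M.smooth M.meas).comp_aemeasurable
    (M.measurable_Y.aemeasurable.prodMk hq.aemeasurable)).aestronglyMeasurable

theorem aestronglyMeasurable_deriv {q : Ω → ℝ} (hq : AEStronglyMeasurable q P) :
    AEStronglyMeasurable (fun ω => deriv (ℓ (Y ω)) (q ω)) P :=
  ((measurable_deriv_loss_uncurry M.smooth M.meas).comp_aemeasurable
    (M.measurable_Y.aemeasurable.prodMk hq.aemeasurable)).aestronglyMeasurable

theorem aestronglyMeasurable_excess {q : Ω → ℝ} (hq : AEStronglyMeasurable q P) :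
    AEStronglyMeasurable (fun ω => excess ℓ (Y ω) (q ω)) P :=
  ((measurable_excess M.smooth M.convex M.meas).comp_aemeasurable
    (M.measurable_Y.aemeasurable.prodMk hq.aemeasurable)).aestronglyMeasurable

theorem memLp_excess {q : Ω → ℝ} (hq : MemLp q 2 P) :
    MemLp (fun ω => excess ℓ (Y ω) (q ω)) 2 P :=
  hq.mono (M.aestronglyMeasurable_excess hq.1)
    (Eventually.of_forall fun _ => abs_excess_le _ _)

theorem measurable_proxVar {γ : ℝ} (hγ : 0 < γ) (a σ : ℝ) :
    Measurable (proxVar ℓ U G Y γ a σ) := by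
  refine measurable_of_Iic fun c => ?_
  have : proxVar ℓ U G Y γ a σ ⁻¹' Iic c
      = {ω | a * U ω + σ * G ω ≤ c + γ * deriv (ℓ (Y ω)) c} := by
    ext ω
    exact (M.convex (Y ω)).prox_le_iff (M.differentiable _) hγ _ _
  rw [this]
  have h1 := (measurable_deriv_loss M.smooth M.meas c).comp M.measurable_Y
  have h2 := M.measurable_U
  have h3 := M.measurable_G
  exact measurableSet_le (by fun_prop) ((h1.const_mul γ).const_add c)

theorem comb_sub_proxVar {γ : ℝ} (hγ : 0 < γ) (a σ : ℝ) (ω : Ω) :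
    a * U ω + σ * G ω - proxVar ℓ U G Y γ a σ ω = γ * scoreVar ℓ U G Y γ a σ ω :=
  (M.convex (Y ω)).convexOn.prox_spec (M.differentiable _) hγ _

/-- Compare the proximal objective at its minimizer with its value at `G`, where the loss is
integrable; the integrable infimum bounds the loss from below. -/
theorem memLp_residual {γ : ℝ} (hγ : 0 < γ) (a σ : ℝ) :
    MemLp (fun ω => a * U ω + σ * G ω - proxVar ℓ U G Y γ a σ ω) 2 P := by
  have hw := M.memLp_comb a σ
  have hG := (hw.sub M.memLp_G).integrable_sq
  refine memLp_two_of_sq_le (hw.1.sub (M.measurable_proxVar hγ a σ).aestronglyMeasurable)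
    (hG.add ((M.integrable_gauss.sub M.integrable_inf).const_mul (2 * γ))) ?_
  filter_upwards [M.bddBelow] with ω hb
  have hγf : ConvexOn ℝ univ fun u => γ * ℓ (Y ω) u := by
    simpa [smul_eq_mul] using (M.convex (Y ω)).convexOn.smul hγ.le
  have h : (a * U ω + σ * G ω - proxVar ℓ U G Y γ a σ ω) ^ 2 / 2
      + γ * ℓ (Y ω) (proxVar ℓ U G Y γ a σ ω)
        ≤ (a * U ω + σ * G ω - G ω) ^ 2 / 2 + γ * ℓ (Y ω) (G ω) :=
    (isMinOn_iff_eq_prox hγf (a * U ω + σ * G ω) _).2 rfl (mem_univ (G ω))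
  have h2 := mul_le_mul_of_nonneg_left (ciInf_le hb (proxVar ℓ U G Y γ a σ ω)) hγ.le
  simp only [Pi.sub_apply, Pi.add_apply]
  linarith

theorem memLp_proxVar {γ : ℝ} (hγ : 0 < γ) (a σ : ℝ) :
    MemLp (proxVar ℓ U G Y γ a σ) 2 P := by
  have := (M.memLp_comb a σ).sub (M.memLp_residual hγ a σ)
  refine this.congr_norm (M.measurable_proxVar hγ a σ).aestronglyMeasurable ?_
  exact Eventually.of_forall fun ω => by simp

theorem memLp_scoreVar {γ : ℝ} (hγ : 0 < γ) (a σ : ℝ) :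
    MemLp (scoreVar ℓ U G Y γ a σ) 2 P := by
  have := (M.memLp_residual hγ a σ).const_mul γ⁻¹
  have e : (fun ω => γ⁻¹ * (a * U ω + σ * G ω - proxVar ℓ U G Y γ a σ ω))
      = scoreVar ℓ U G Y γ a σ := by
    funext ω
    rw [M.comb_sub_proxVar hγ]
    field_simp
  rwa [e] at this

/-- The nonlinear system in terms of the residual `a U + σ G - prox[γ ℓ_Y](a U + σ G)`. -/
theorem isSystemSolution_iff {δ γ a σ : ℝ} :
    IsSystemSolution ℓ P U G Y δ γ a σ ↔ 0 < γ ∧ 0 < σ ∧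
      (∫ ω, (a * U ω + σ * G ω - proxVar ℓ U G Y γ a σ ω) ^ 2 ∂P = δ⁻¹ * σ ^ 2) ∧
      (∫ ω, U ω * (a * U ω + σ * G ω - proxVar ℓ U G Y γ a σ ω) ∂P = 0) ∧
      ∫ ω, G ω * (a * U ω + σ * G ω - proxVar ℓ U G Y γ a σ ω) ∂P = σ * δ⁻¹ := by
  have key : 0 < γ →
      (∫ ω, (a * U ω + σ * G ω - proxVar ℓ U G Y γ a σ ω) ^ 2 ∂P
        = γ ^ 2 * ∫ ω, scoreVar ℓ U G Y γ a σ ω ^ 2 ∂P) ∧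
      (∫ ω, U ω * (a * U ω + σ * G ω - proxVar ℓ U G Y γ a σ ω) ∂P
        = γ * ∫ ω, U ω * scoreVar ℓ U G Y γ a σ ω ∂P) ∧
      ∫ ω, G ω * (a * U ω + σ * G ω - proxVar ℓ U G Y γ a σ ω) ∂P
        = σ - ∫ ω, G ω * proxVar ℓ U G Y γ a σ ω ∂P := by
    intro hγ
    refine ⟨?_, ?_, ?_⟩
    · rw [← integral_const_mul]
      refine integral_congr_ae (Eventually.of_forall fun ω => ?_)
      simp only [M.comb_sub_proxVar hγ]
      ring
    · rw [← integral_const_mul]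
      refine integral_congr_ae (Eventually.of_forall fun ω => ?_)
      simp only [M.comb_sub_proxVar hγ]
      ring
    · have h1 : Integrable (fun ω => G ω * (a * U ω + σ * G ω)) P :=
        M.memLp_G.integrable_mul (M.memLp_comb a σ)
      have h2 : Integrable (fun ω => G ω * proxVar ℓ U G Y γ a σ ω) P :=
        M.memLp_G.integrable_mul (M.memLp_proxVar hγ a σ)
      have h3 : Integrable (fun ω => a * (U ω * G ω)) P :=
        (M.memLp_U.integrable_mul M.memLp_G).const_mul a
      have h4 : Integrable (fun ω => σ * G ω ^ 2) P := M.memLp_G.integrable_sq.const_mul σ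
      have e : ∀ ω, G ω * (a * U ω + σ * G ω) = a * (U ω * G ω) + σ * G ω ^ 2 :=
        fun ω => by ring
      simp only [mul_sub]
      rw [integral_sub h1 h2]
      simp only [e]
      rw [integral_add h3 h4, integral_const_mul, integral_const_mul, M.integral_U_mul_G,
        M.integral_G_sq]
      simp
  constructor
  · rintro ⟨hγ, hσ, h1, h2, h3⟩
    obtain ⟨k1, k2, k3⟩ := key hγ
    refine ⟨hγ, hσ, ?_, ?_, ?_⟩
    · rw [k1, ← h1]
      field_simp
    · rw [k2, ← h2, mul_zero]
    · rw [k3, ← h3]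
      ring
  · rintro ⟨hγ, hσ, h1, h2, h3⟩
    obtain ⟨k1, k2, k3⟩ := key hγ
    refine ⟨hγ, hσ, ?_, ?_, ?_⟩
    · rw [k1] at h1
      rw [mul_assoc, ← h1]
      field_simp
    · rw [k2] at h2
      exact ((mul_eq_zero.1 h2).resolve_left hγ.ne').symm
    · rw [k3] at h3
      linarith

end IsLossModel

/-! ### The threshold function and the duality satisfied by a solution. -/

namespace IsLossModel

variable {Ω : Type*} [MeasurableSpace Ω] {P : Measure Ω} {𝒴 : Set ℝ}
  {ℓ : 𝒴 → ℝ → ℝ} {U G : Ω → ℝ} {Y : Ω → 𝒴} (M : IsLossModel P ℓ U G Y)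
include M

/-- On each of the three label classes the integrand of `phi` is the squared distance to the
recession cone of the loss. -/
theorem phi_eq (t : ℝ) :
    phi ℓ P U G Y t = ∫ ω, excess ℓ (Y ω) (t * U ω + 1 * G ω) ^ 2 ∂P := by
  have hE := (M.memLp_excess (M.memLp_comb t 1)).integrable_sq
  have hc := M.measurable_Y (measurableSet_coerciveLabels M.smooth M.convex M.meas)
  have hi := M.measurable_Y (measurableSet_increasingLabels M.smooth M.convex M.meas)
  have hd := M.measurable_Y (measurableSet_decreasingLabels M.smooth M.convex M.meas)
  have e1 : (Y ⁻¹' coerciveLabels ℓ).indicator (fun ω => (G ω + U ω * t) ^ 2)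
      = (Y ⁻¹' coerciveLabels ℓ).indicator
        (fun ω => excess ℓ (Y ω) (t * U ω + 1 * G ω) ^ 2) := by
    refine indicator_congr fun ω hω => ?_
    rw [excess_of_coercive hω]
    ring
  have e2 : (Y ⁻¹' increasingLabels ℓ).indicator (fun ω => max (G ω + U ω * t) 0 ^ 2)
      = (Y ⁻¹' increasingLabels ℓ).indicator
        (fun ω => excess ℓ (Y ω) (t * U ω + 1 * G ω) ^ 2) := by
    refine indicator_congr fun ω hω => ?_
    rw [excess_of_increasing hω, show t * U ω + 1 * G ω = G ω + U ω * t by ring]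
  have e3 : (Y ⁻¹' decreasingLabels ℓ).indicator (fun ω => max (-(G ω + U ω * t)) 0 ^ 2)
      = (Y ⁻¹' decreasingLabels ℓ).indicator
        (fun ω => excess ℓ (Y ω) (t * U ω + 1 * G ω) ^ 2) := by
    refine indicator_congr fun ω hω => ?_
    rw [excess_of_decreasing hω, show t * U ω + 1 * G ω = G ω + U ω * t by ring,
      ← neg_sq (min _ _), ← max_neg_neg, neg_zero]
  have hci : Integrable (fun ω =>
      (Y ⁻¹' coerciveLabels ℓ).indicator (fun ω => excess ℓ (Y ω) (t * U ω + 1 * G ω) ^ 2) ω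
        + (Y ⁻¹' increasingLabels ℓ).indicator
          (fun ω => excess ℓ (Y ω) (t * U ω + 1 * G ω) ^ 2) ω) P :=
    (hE.indicator hc).add (hE.indicator hi)
  rw [phi, e1, e2, e3, ← integral_add (hE.indicator hc) (hE.indicator hi),
    ← integral_add hci (hE.indicator hd)]
  refine integral_congr_ae (Eventually.of_forall fun ω => ?_)
  rcases label_trichotomy M.smooth M.convex (Y ω) with h | h | h
  · have h1 : Y ω ∉ increasingLabels ℓ := fun h' => StrictMono.not_tendsto_cocompact_atTop h' h
    have h2 : Y ω ∉ decreasingLabels ℓ := fun h' => (decreasing_notMem h').1 h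
    simp [indicator, h, h1, h2]
  · have h1 : Y ω ∉ coerciveLabels ℓ := StrictMono.not_tendsto_cocompact_atTop h
    have h2 : Y ω ∉ decreasingLabels ℓ := fun h' => (decreasing_notMem h').2 h
    simp [indicator, h, h1, h2]
  · simp [indicator, h, (decreasing_notMem h).1, (decreasing_notMem h).2]

theorem phi_nonneg (t : ℝ) : 0 ≤ phi ℓ P U G Y t := by
  rw [M.phi_eq]
  exact integral_nonneg fun ω => sq_nonneg _

theorem bddBelow_phi : BddBelow (range (phi ℓ P U G Y)) :=
  ⟨0, by rintro _ ⟨t, rfl⟩; exact M.phi_nonneg t⟩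

theorem continuous_phi : Continuous (phi ℓ P U G Y) := by
  have e : phi ℓ P U G Y = fun t => ∫ ω, excess ℓ (Y ω) (t * U ω + 1 * G ω) ^ 2 ∂P :=
    funext M.phi_eq
  rw [e, continuous_iff_continuousAt]
  intro t₀
  refine continuousAt_of_dominated (bound := fun ω => ((|t₀| + 1) * |U ω| + 1 * |G ω|) ^ 2)
    (Eventually.of_forall fun t => ((M.memLp_excess (M.memLp_comb t 1)).1.pow 2)) ?_ ?_ ?_
  · filter_upwards [Metric.ball_mem_nhds t₀ one_pos] with t ht
    refine Eventually.of_forall fun ω => ?_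
    rw [Real.norm_of_nonneg (sq_nonneg _), ← sq_abs]
    refine pow_le_pow_left₀ (abs_nonneg _) ((abs_excess_le _ _).trans ?_) 2
    refine (abs_add_le _ _).trans ?_
    rw [abs_mul, abs_mul, abs_one]
    have h1 : |t| ≤ |t₀| + 1 := by
      rw [Metric.mem_ball, Real.dist_eq] at ht
      have := abs_sub_abs_le_abs_sub t t₀
      linarith
    gcongr
  · exact ((M.memLp_U.abs.const_mul _).add (M.memLp_G.abs.const_mul _)).integrable_sq
  · refine Eventually.of_forall fun ω => ?_
    exact ((((continuous_excess (Y ω)).comp (by fun_prop)).pow 2).continuousAt)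

/-- On the events in the non-triviality assumption, one for each sign of `t`, the excess of `t * U`
is `t * U` itself. So neither `U` nor `-U` is a recession direction, and the smaller of the two
expectations serves as `c`. -/
theorem exists_mul_sq_le_integral_excess :
    ∃ c : ℝ, 0 < c ∧ ∀ t : ℝ, c * t ^ 2 ≤ ∫ ω, excess ℓ (Y ω) (t * U ω) ^ 2 ∂P := by
  have hint : ∀ t : ℝ, Integrable (fun ω => excess ℓ (Y ω) (t * U ω) ^ 2) P := fun t =>
    (M.memLp_excess (M.memLp_U.const_mul t)).integrable_sq
  have hmain : ∀ (t : ℝ) (A : Set Ω), 0 < ∫ ω, A.indicator (fun ω => U ω ^ 2) ω ∂P →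
      (∀ ω ∈ A, (t * U ω) ^ 2 ≤ excess ℓ (Y ω) (t * U ω) ^ 2) →
      (∫ ω, A.indicator (fun ω => U ω ^ 2) ω ∂P) * t ^ 2
        ≤ ∫ ω, excess ℓ (Y ω) (t * U ω) ^ 2 ∂P := by
    intro t A h0 hA
    rw [← integral_mul_const]
    refine integral_mono_of_nonneg (Eventually.of_forall fun ω => ?_) (hint t)
      (Eventually.of_forall fun ω => ?_)
    · exact mul_nonneg (indicator_nonneg (fun _ _ => sq_nonneg _) _) (sq_nonneg _)
    · by_cases hω : ω ∈ A
      · simp only [indicator_of_mem hω]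
        have := hA ω hω
        rwa [mul_pow, mul_comm] at this
      · simp only [indicator_of_notMem hω, zero_mul]
        exact sq_nonneg _
  refine ⟨_, lt_min M.nontrivial_pos M.nontrivial_neg, fun t => ?_⟩
  rcases lt_trichotomy t 0 with ht | rfl | ht
  · refine (mul_le_mul_of_nonneg_right (min_le_right _ _) (sq_nonneg _)).trans
      (hmain t _ M.nontrivial_neg ?_)
    rintro ω ((h | ⟨h, h'⟩) | ⟨h, h'⟩)
    · rw [excess_of_coercive h]
    · rw [excess_of_decreasing h, min_eq_left (mul_nonpos_of_nonpos_of_nonneg ht.le (le_of_lt h'))]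
    · rw [excess_of_increasing h, max_eq_left (mul_nonneg_of_nonpos_of_nonpos ht.le (le_of_lt h'))]
  · simp only [ne_eq, OfNat.ofNat_ne_zero, not_false_eq_true, zero_pow, mul_zero]
    exact integral_nonneg fun ω => sq_nonneg _
  · refine (mul_le_mul_of_nonneg_right (min_le_left _ _) (sq_nonneg _)).trans
      (hmain t _ M.nontrivial_pos ?_)
    rintro ω ((h | ⟨h, h'⟩) | ⟨h, h'⟩)
    · rw [excess_of_coercive h]
    · rw [excess_of_decreasing h, min_eq_left (mul_nonpos_of_nonneg_of_nonpos ht.le (le_of_lt h'))]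
    · rw [excess_of_increasing h, max_eq_left (mul_nonneg ht.le (le_of_lt h'))]

theorem tendsto_phi_cocompact [IsProbabilityMeasure P] :
    Tendsto (phi ℓ P U G Y) (cocompact ℝ) atTop := by
  obtain ⟨c, hc, hle⟩ := M.exists_mul_sq_le_integral_excess
  have hlow : ∀ t, c / 2 * ‖t‖ ^ 2 - 1 ≤ phi ℓ P U G Y t := by
    intro t
    -- The excess is 1-Lipschitz, so adding `G` inside it costs at most `|G|`.
    have h1 : ∫ ω, excess ℓ (Y ω) (t * U ω) ^ 2 ∂P
        ≤ ∫ ω, (2 * excess ℓ (Y ω) (t * U ω + 1 * G ω) ^ 2 + 2 * G ω ^ 2) ∂P := by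
      refine integral_mono (M.memLp_excess (M.memLp_U.const_mul t)).integrable_sq
        (((M.memLp_excess (M.memLp_comb t 1)).integrable_sq.const_mul 2).add
          (M.memLp_G.integrable_sq.const_mul 2)) fun ω => ?_
      have h := abs_excess_sub_excess_le (ℓ := ℓ) (Y ω) (t * U ω) (t * U ω + 1 * G ω)
      rw [show t * U ω - (t * U ω + 1 * G ω) = -G ω by ring, abs_neg] at h
      have h' := sq_le_sq.2 h
      simp only
      nlinarith [sq_nonneg (excess ℓ (Y ω) (t * U ω) - 2 * excess ℓ (Y ω) (t * U ω + 1 * G ω))]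
    rw [integral_add ((M.memLp_excess (M.memLp_comb t 1)).integrable_sq.const_mul 2)
          (M.memLp_G.integrable_sq.const_mul 2), integral_const_mul, integral_const_mul,
      ← M.phi_eq, M.integral_G_sq] at h1
    have := hle t
    rw [Real.norm_eq_abs, sq_abs]
    linarith
  refine tendsto_atTop_mono hlow ?_
  apply tendsto_atTop_add_const_right
  exact ((tendsto_pow_atTop two_ne_zero).comp (tendsto_norm_cocompact_atTop)).const_mul_atTop
    (by positivity)

/-- Attainment of the infimum is what covers the critical case δ = δ_∞. -/
theorem exists_phi_eq_iInf [IsProbabilityMeasure P] :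
    ∃ t, phi ℓ P U G Y t = ⨅ s, phi ℓ P U G Y s := by
  obtain ⟨t, ht⟩ := M.continuous_phi.exists_forall_le M.tendsto_phi_cocompact
  exact ⟨t, le_antisymm (le_ciInf ht) (ciInf_le M.bddBelow_phi t)⟩

omit M in
theorem le_criticalThreshold_iff {δ : ℝ} (hδ : 0 < δ) :
    ENNReal.ofReal δ ≤ criticalThreshold ℓ P U G Y ↔ ⨅ t, phi ℓ P U G Y t ≤ δ⁻¹ := by
  rw [criticalThreshold, ← ENNReal.inv_le_inv, inv_inv, ← ENNReal.ofReal_inv_of_pos hδ,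
    ENNReal.ofReal_le_ofReal_iff (by positivity)]

open scoped RealInnerProductSpace

theorem norm_toLp_U [IsProbabilityMeasure P] : ‖M.memLp_U.toLp U‖ = 1 := by
  rw [← sq_eq_sq₀ (norm_nonneg _) zero_le_one, norm_toLp_sq_eq_integral, M.integral_U_sq, one_pow]

theorem norm_toLp_G [IsProbabilityMeasure P] : ‖M.memLp_G.toLp G‖ = 1 := by
  rw [← sq_eq_sq₀ (norm_nonneg _) zero_le_one, norm_toLp_sq_eq_integral, M.integral_G_sq, one_pow]

theorem inner_toLp_U_G : ⟪M.memLp_U.toLp U, M.memLp_G.toLp G⟫ = 0 := by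
  rw [inner_toLp_eq_integral, M.integral_U_mul_G]

theorem toLp_mem_ballCone_of_integral_le {c t τ : ℝ} (hc : 0 ≤ c) (hτ : 0 ≤ τ) {d : Ω → ℝ}
    (hd : MemLp d 2 P) (h : ∫ ω, (t * U ω + τ * G ω - d ω) ^ 2 ∂P ≤ c ^ 2 * τ ^ 2) :
    hd.toLp d ∈ ballCone (M.memLp_U.toLp U) (M.memLp_G.toLp G) c := by
  refine ⟨t, τ, hτ, le_of_sq_le_sq ?_ (by positivity)⟩
  have e : t • M.memLp_U.toLp U + τ • M.memLp_G.toLp G - hd.toLp d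
      = ((M.memLp_comb t τ).sub hd).toLp _ := rfl
  rw [e, norm_toLp_sq_eq_integral, mul_pow]
  exact h

/-- The residual of a solution lies in the polar of the cone of feasible directions. -/
theorem integral_residual_mul_nonneg {γ a σ c : ℝ} (hc : 0 ≤ c) {δ : ℝ}
    (hδ : c ^ 2 = δ⁻¹) (h : IsSystemSolution ℓ P U G Y δ γ a σ) {d : Ω → ℝ} (hd : MemLp d 2 P)
    {t τ : ℝ} (hτ : 0 ≤ τ) (hle : ∫ ω, (t * U ω + τ * G ω - d ω) ^ 2 ∂P ≤ c ^ 2 * τ ^ 2)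
    [IsProbabilityMeasure P] :
    0 ≤ ∫ ω, scoreVar ℓ U G Y γ a σ ω * d ω ∂P := by
  obtain ⟨hγ, hσ, h1, h2, h3⟩ := M.isSystemSolution_iff.1 h
  have hr := M.memLp_residual hγ a σ
  have key : 0 ≤ ⟪hr.toLp _, hd.toLp d⟫ := by
    refine inner_nonneg_of_mem_ballCone (c := c) hc hσ.le ?_ ?_ ?_
      (M.toLp_mem_ballCone_of_integral_le hc hτ hd hle)
    · rw [inner_toLp_eq_integral, h2]
    · rw [inner_toLp_eq_integral, h3, hδ]
    · rw [← sq_eq_sq₀ (norm_nonneg _) (by positivity), norm_toLp_sq_eq_integral, h1, mul_pow, hδ]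
  rw [inner_toLp_eq_integral] at key
  simp only [M.comb_sub_proxVar hγ, mul_assoc] at key
  rw [integral_const_mul] at key
  exact (mul_nonneg_iff_of_pos_left hγ).1 key

end IsLossModel

/-! ### Nonexistence up to the threshold, and uniqueness. -/

namespace IsLossModel

variable {Ω : Type*} [MeasurableSpace Ω] {P : Measure Ω} [IsProbabilityMeasure P] {𝒴 : Set ℝ}
  {ℓ : 𝒴 → ℝ → ℝ} {U G : Ω → ℝ} {Y : Ω → 𝒴} (M : IsLossModel P ℓ U G Y)
include M

omit [IsProbabilityMeasure P] in
theorem integral_comb_sq (a σ : ℝ) :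
    ∫ ω, (a * U ω + σ * G ω) ^ 2 ∂P = a ^ 2 + σ ^ 2 := by
  have h1 : Integrable (fun ω => a ^ 2 * U ω ^ 2) P := M.memLp_U.integrable_sq.const_mul _
  have h2 : Integrable (fun ω => 2 * a * σ * (U ω * G ω)) P :=
    (M.memLp_U.integrable_mul M.memLp_G).const_mul _
  have h3 : Integrable (fun ω => σ ^ 2 * G ω ^ 2) P := M.memLp_G.integrable_sq.const_mul _
  have e : ∀ ω, (a * U ω + σ * G ω) ^ 2
      = a ^ 2 * U ω ^ 2 + 2 * a * σ * (U ω * G ω) + σ ^ 2 * G ω ^ 2 := fun ω => by ring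
  have h12 : Integrable (fun ω => a ^ 2 * U ω ^ 2 + 2 * a * σ * (U ω * G ω)) P := h1.add h2
  simp only [e]
  rw [integral_add h12 h3, integral_add h1 h2, integral_const_mul, integral_const_mul,
    integral_const_mul, M.integral_U_sq, M.integral_G_sq, M.integral_U_mul_G]
  ring

/-- At a minimizer `t` of φ, the projection of `t U + G` onto the recession cone is feasible, so
duality makes its pairing with the score nonnegative, whereas pointwise the product is nonpositive.
-/
theorem not_isSystemSolution {δ : ℝ} (hδ : 1 < δ) (hthr : ⨅ t, phi ℓ P U G Y t ≤ δ⁻¹)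
    (γ a σ : ℝ) : ¬ IsSystemSolution ℓ P U G Y δ γ a σ := by
  intro hsol
  have hγ := hsol.gamma_pos
  have hδ0 : 0 < δ⁻¹ := by positivity
  obtain ⟨t, ht⟩ := M.exists_phi_eq_iInf
  have hE := M.memLp_excess (M.memLp_comb t 1)
  have hd := (M.memLp_comb t 1).sub hE
  have hs := M.memLp_scoreVar hγ a σ
  have hsd : Integrable (fun ω => scoreVar ℓ U G Y γ a σ ω *
      ((t * U ω + 1 * G ω) - excess ℓ (Y ω) (t * U ω + 1 * G ω))) P := hs.integrable_mul hd
  have hpos := M.integral_residual_mul_nonneg (c := √δ⁻¹) (Real.sqrt_nonneg _)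
    (Real.sq_sqrt hδ0.le) hsol hd (t := t) (τ := 1) zero_le_one (by
      simp only [Pi.sub_apply, sub_sub_cancel]
      rw [← M.phi_eq, ht, Real.sq_sqrt hδ0.le]
      linarith)
  have hneg : ∀ ω, scoreVar ℓ U G Y γ a σ ω *
      ((t * U ω + 1 * G ω) - excess ℓ (Y ω) (t * U ω + 1 * G ω)) ≤ 0 := fun ω =>
    (deriv_mul_sub_excess M.smooth M.convex (Y ω) _ _).1
  have hzero : ∫ ω, -(scoreVar ℓ U G Y γ a σ ω *
      ((t * U ω + 1 * G ω) - excess ℓ (Y ω) (t * U ω + 1 * G ω))) ∂P = 0 := by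
    refine le_antisymm ?_ (integral_nonneg fun ω => neg_nonneg.2 (hneg ω))
    rw [integral_neg]
    simpa using hpos
  rw [integral_eq_zero_iff_of_nonneg (fun ω => neg_nonneg.2 (hneg ω)) hsd.neg] at hzero
  -- A vanishing product forces the projection to vanish, so the distance to the recession cone is
  -- the full norm of `t U + G`.
  have hphi : phi ℓ P U G Y t = t ^ 2 + 1 ^ 2 := by
    rw [M.phi_eq, ← M.integral_comb_sq t 1]
    refine integral_congr_ae ?_
    filter_upwards [hzero] with ω hω
    rw [(deriv_mul_sub_excess M.smooth M.convex (Y ω) _ _).2 (neg_eq_zero.1 hω)]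
  have : δ⁻¹ < 1 := inv_lt_one_of_one_lt₀ hδ
  rw [← ht, hphi] at hthr
  nlinarith [sq_nonneg t]

omit [IsProbabilityMeasure P] in
-- Complementary slackness: with w = aU + σG and residual r, the equations give ⟨r, w⟩ = σ²/δ =
-- ‖r‖², so r is orthogonal to w - r.
theorem integral_score_mul_prox {δ γ a σ : ℝ} (h : IsSystemSolution ℓ P U G Y δ γ a σ) :
    ∫ ω, scoreVar ℓ U G Y γ a σ ω * proxVar ℓ U G Y γ a σ ω ∂P = 0 := by
  obtain ⟨hγ, hσ, h1, h2, h3⟩ := M.isSystemSolution_iff.1 h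
  have hr := M.memLp_residual hγ a σ
  have k1 := (M.memLp_U.integrable_mul hr).const_mul a
  have k2 := (M.memLp_G.integrable_mul hr).const_mul σ
  have k12 := k1.add k2
  have e : ∀ ω, γ * (scoreVar ℓ U G Y γ a σ ω * proxVar ℓ U G Y γ a σ ω)
      = a * (U ω * (a * U ω + σ * G ω - proxVar ℓ U G Y γ a σ ω))
        + σ * (G ω * (a * U ω + σ * G ω - proxVar ℓ U G Y γ a σ ω))
        - (a * U ω + σ * G ω - proxVar ℓ U G Y γ a σ ω) ^ 2 := by
    intro ω
    rw [← mul_assoc, ← M.comb_sub_proxVar hγ]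
    ring
  have : γ * ∫ ω, scoreVar ℓ U G Y γ a σ ω * proxVar ℓ U G Y γ a σ ω ∂P = 0 := by
    rw [← integral_const_mul]
    simp only [e]
    rw [integral_sub, integral_add, integral_const_mul, integral_const_mul, h1, h2, h3]
    · ring
    · exact k1
    · exact k2
    · exact k12
    · exact hr.integrable_sq
  exact (mul_eq_zero.1 this).resolve_left hγ.ne'

/-- Each score is orthogonal to its own solution and pairs nonnegatively with the other one, which
contradicts strict monotonicity of the derivative unless the solutions agree. -/
theorem proxVar_ae_eq {δ γ a σ γ' a' σ' : ℝ} (hδ : 0 < δ)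
    (h : IsSystemSolution ℓ P U G Y δ γ a σ) (h' : IsSystemSolution ℓ P U G Y δ γ' a' σ') :
    proxVar ℓ U G Y γ a σ =ᵐ[P] proxVar ℓ U G Y γ' a' σ' := by
  have hδ0 : 0 < δ⁻¹ := by positivity
  have key : ∀ {γ a σ γ' a' σ' : ℝ}, IsSystemSolution ℓ P U G Y δ γ a σ →
      IsSystemSolution ℓ P U G Y δ γ' a' σ' →
      0 ≤ ∫ ω, scoreVar ℓ U G Y γ a σ ω * proxVar ℓ U G Y γ' a' σ' ω ∂P := by
    intro γ a σ γ' a' σ' h h'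
    obtain ⟨hγ', hσ', h1', -, -⟩ := M.isSystemSolution_iff.1 h'
    refine M.integral_residual_mul_nonneg (c := √δ⁻¹) (Real.sqrt_nonneg _)
      (Real.sq_sqrt hδ0.le) h (M.memLp_proxVar hγ' a' σ') (t := a') hσ'.le ?_
    rw [h1', Real.sq_sqrt hδ0.le]
  have hs := M.memLp_scoreVar h.gamma_pos a σ
  have hs' := M.memLp_scoreVar h'.gamma_pos a' σ'
  have hq := M.memLp_proxVar h.gamma_pos a σ
  have hq' := M.memLp_proxVar h'.gamma_pos a' σ'
  have hd : ∀ ω, 0 ≤ (scoreVar ℓ U G Y γ a σ ω - scoreVar ℓ U G Y γ' a' σ' ω)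
      * (proxVar ℓ U G Y γ a σ ω - proxVar ℓ U G Y γ' a' σ' ω) := by
    intro ω
    have hm := (M.convex (Y ω)).strictMono_deriv (M.differentiable _)
    rcases le_total (proxVar ℓ U G Y γ a σ ω) (proxVar ℓ U G Y γ' a' σ' ω) with hle | hle
    · exact mul_nonneg_of_nonpos_of_nonpos (sub_nonpos.2 (hm.monotone hle)) (sub_nonpos.2 hle)
    · exact mul_nonneg (sub_nonneg.2 (hm.monotone hle)) (sub_nonneg.2 hle)
  have hint : Integrable (fun ω => (scoreVar ℓ U G Y γ a σ ω - scoreVar ℓ U G Y γ' a' σ' ω)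
      * (proxVar ℓ U G Y γ a σ ω - proxVar ℓ U G Y γ' a' σ' ω)) P :=
    (hs.sub hs').integrable_mul (hq.sub hq')
  have hzero : ∫ ω, (scoreVar ℓ U G Y γ a σ ω - scoreVar ℓ U G Y γ' a' σ' ω)
      * (proxVar ℓ U G Y γ a σ ω - proxVar ℓ U G Y γ' a' σ' ω) ∂P = 0 := by
    refine le_antisymm ?_ (integral_nonneg hd)
    have e : ∀ ω, (scoreVar ℓ U G Y γ a σ ω - scoreVar ℓ U G Y γ' a' σ' ω)
        * (proxVar ℓ U G Y γ a σ ω - proxVar ℓ U G Y γ' a' σ' ω)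
        = (scoreVar ℓ U G Y γ a σ ω * proxVar ℓ U G Y γ a σ ω
          + scoreVar ℓ U G Y γ' a' σ' ω * proxVar ℓ U G Y γ' a' σ' ω)
          - (scoreVar ℓ U G Y γ a σ ω * proxVar ℓ U G Y γ' a' σ' ω
          + scoreVar ℓ U G Y γ' a' σ' ω * proxVar ℓ U G Y γ a σ ω) := fun ω => by ring
    have i1 := hs.integrable_mul hq
    have i2 := hs'.integrable_mul hq'
    have i3 := hs.integrable_mul hq'
    have i4 := hs'.integrable_mul hq
    simp only [e]
    rw [integral_sub, integral_add, integral_add, M.integral_score_mul_prox h,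
      M.integral_score_mul_prox h']
    · linarith [key h h', key h' h]
    · exact i3
    · exact i4
    · exact i1
    · exact i2
    · exact i1.add i2
    · exact i3.add i4
  rw [integral_eq_zero_iff_of_nonneg hd hint] at hzero
  filter_upwards [hzero] with ω hω
  rcases mul_eq_zero.1 hω with h0 | h0
  · exact ((M.convex (Y ω)).strictMono_deriv (M.differentiable _)).injective (sub_eq_zero.1 h0)
  · exact sub_eq_zero.1 h0

theorem isSystemSolution_unique {δ γ a σ γ' a' σ' : ℝ} (hδ : 1 < δ)
    (h : IsSystemSolution ℓ P U G Y δ γ a σ) (h' : IsSystemSolution ℓ P U G Y δ γ' a' σ') :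
    γ = γ' ∧ a = a' ∧ σ = σ' := by
  have hδ0 : 0 < δ⁻¹ := by positivity
  have hδ1 : 0 < 1 - δ⁻¹ := sub_pos.2 (inv_lt_one_of_one_lt₀ hδ)
  have hq := M.proxVar_ae_eq (zero_lt_one.trans hδ) h h'
  have ha : ∀ {γ a σ : ℝ}, IsSystemSolution ℓ P U G Y δ γ a σ →
      ∫ ω, U ω * proxVar ℓ U G Y γ a σ ω ∂P = a := by
    intro γ a σ h
    obtain ⟨hγ, -, -, h2, -⟩ := M.isSystemSolution_iff.1 h
    have i1 : Integrable (fun ω => a * U ω ^ 2) P := M.memLp_U.integrable_sq.const_mul a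
    have i2 : Integrable (fun ω => σ * (U ω * G ω)) P :=
      (M.memLp_U.integrable_mul M.memLp_G).const_mul σ
    have i12 : Integrable (fun ω => a * U ω ^ 2 + σ * (U ω * G ω)) P := i1.add i2
    have i3 : Integrable (fun ω => U ω * proxVar ℓ U G Y γ a σ ω) P :=
      M.memLp_U.integrable_mul (M.memLp_proxVar hγ a σ)
    have e : ∀ ω, U ω * (a * U ω + σ * G ω - proxVar ℓ U G Y γ a σ ω)
        = a * U ω ^ 2 + σ * (U ω * G ω) - U ω * proxVar ℓ U G Y γ a σ ω := fun ω => by ring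
    simp only [e] at h2
    rw [integral_sub i12 i3, integral_add i1 i2, integral_const_mul, integral_const_mul,
      M.integral_U_sq, M.integral_U_mul_G] at h2
    linarith
  have haa : a = a' := by
    rw [← ha h, ← ha h']
    refine integral_congr_ae ?_
    filter_upwards [hq] with ω hω
    rw [hω]
  have hσσ : σ = σ' := by
    have h3 := h.eq_three
    have h3' := h'.eq_three
    have : ∫ ω, G ω * proxVar ℓ U G Y γ a σ ω ∂P = ∫ ω, G ω * proxVar ℓ U G Y γ' a' σ' ω ∂P := by
      refine integral_congr_ae ?_
      filter_upwards [hq] with ω hω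
      rw [hω]
    rw [this, ← h3'] at h3
    exact mul_right_cancel₀ hδ1.ne' h3
  refine ⟨?_, haa, hσσ⟩
  have h1 := h.eq_one
  have h1' := h'.eq_one
  have : ∫ ω, scoreVar ℓ U G Y γ a σ ω ^ 2 ∂P = ∫ ω, scoreVar ℓ U G Y γ' a' σ' ω ^ 2 ∂P := by
    refine integral_congr_ae ?_
    filter_upwards [hq] with ω hω
    rw [scoreVar, scoreVar, hω]
  rw [this, ← h1', ← hσσ, mul_assoc, mul_assoc] at h1
  have hp : 0 < δ⁻¹ * σ ^ 2 := mul_pos hδ0 (pow_pos h.sigma_pos 2)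
  have := mul_right_cancel₀ hp.ne' h1
  rw [inv_inj] at this
  exact (sq_eq_sq₀ h.gamma_pos.le h'.gamma_pos.le).1 this

end IsLossModel

/-! ### The excess risk: lower semicontinuity, convexity, coercivity on the cone. -/

/-- The expected loss of the prediction `q`, relative to the infimum of the loss. -/
noncomputable def excessRisk {Ω : Type*} [MeasurableSpace Ω] (P : Measure Ω) {𝒴 : Set ℝ}
    (ℓ : 𝒴 → ℝ → ℝ) (Y : Ω → 𝒴) (q : Ω → ℝ) : ENNReal :=
  ∫⁻ ω, ENNReal.ofReal (ℓ (Y ω) (q ω) - ⨅ u : ℝ, ℓ (Y ω) u) ∂P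

namespace IsLossModel

variable {Ω : Type*} [MeasurableSpace Ω] {P : Measure Ω} {𝒴 : Set ℝ}
  {ℓ : 𝒴 → ℝ → ℝ} {U G : Ω → ℝ} {Y : Ω → 𝒴}

theorem excessRisk_congr {q q' : Ω → ℝ} (h : q =ᵐ[P] q') :
    excessRisk P ℓ Y q = excessRisk P ℓ Y q' := by
  refine lintegral_congr_ae ?_
  filter_upwards [h] with ω hω
  rw [hω]

variable (M : IsLossModel P ℓ U G Y)
include M

theorem aemeasurable_excessLoss {q : Ω → ℝ} (hq : AEStronglyMeasurable q P) :
    AEMeasurable (fun ω => ENNReal.ofReal (ℓ (Y ω) (q ω) - ⨅ u : ℝ, ℓ (Y ω) u)) P :=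
  ((M.aestronglyMeasurable_loss hq).aemeasurable.sub M.integrable_inf.1.aemeasurable).ennreal_ofReal

theorem excessRisk_gauss_ne_top : excessRisk P ℓ Y G ≠ ⊤ :=
  ((M.integrable_gauss.sub M.integrable_inf).lintegral_lt_top).ne

theorem isClosed_excessRisk_le (c : ENNReal) :
    IsClosed {q : Lp ℝ 2 P | excessRisk P ℓ Y q ≤ c} := by
  refine IsSeqClosed.isClosed fun q x hq hx => ?_
  -- Fatou's lemma along an almost surely convergent subsequence.
  obtain ⟨ns, -, hns⟩ := (tendstoInMeasure_of_tendsto_Lp hx).exists_seq_tendsto_ae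
  have h1 : excessRisk P ℓ Y x ≤ ∫⁻ ω, liminf (fun n =>
      ENNReal.ofReal (ℓ (Y ω) (q (ns n) ω) - ⨅ u : ℝ, ℓ (Y ω) u)) atTop ∂P := by
    refine lintegral_mono_ae ?_
    filter_upwards [hns] with ω hω
    have hc : Continuous fun u => ENNReal.ofReal (ℓ (Y ω) u - ⨅ u : ℝ, ℓ (Y ω) u) := by
      have := (M.differentiable (Y ω)).continuous
      exact ENNReal.continuous_ofReal.comp (by fun_prop)
    exact ((hc.tendsto _).comp hω).liminf_eq.ge
  refine h1.trans ((lintegral_liminf_le' fun n =>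
    M.aemeasurable_excessLoss (Lp.aestronglyMeasurable _)).trans ?_)
  exact liminf_le_of_le (by isBoundedDefault) fun b hb => by
    obtain ⟨n, hn⟩ := hb.exists
    exact hn.trans (hq (ns n))

theorem excessRisk_comb_le {q q' : Ω → ℝ} (hq : AEStronglyMeasurable q P)
    {a b : ℝ} (ha : 0 ≤ a) (hb : 0 ≤ b)
    (hab : a + b = 1) : excessRisk P ℓ Y (fun ω => a * q ω + b * q' ω)
      ≤ ENNReal.ofReal a * excessRisk P ℓ Y q + ENNReal.ofReal b * excessRisk P ℓ Y q' := by
  unfold excessRisk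
  rw [← lintegral_const_mul' _ _ ENNReal.ofReal_ne_top,
    ← lintegral_const_mul' _ _ ENNReal.ofReal_ne_top,
    ← lintegral_add_left' ((M.aemeasurable_excessLoss hq).const_mul _)]
  refine lintegral_mono_ae ?_
  filter_upwards [M.bddBelow] with ω hω
  have h0 : ∀ u, 0 ≤ ℓ (Y ω) u - ⨅ u : ℝ, ℓ (Y ω) u := fun u => sub_nonneg.2 (ciInf_le hω u)
  rw [← ENNReal.ofReal_mul ha, ← ENNReal.ofReal_mul hb, ← ENNReal.ofReal_add
    (mul_nonneg ha (h0 _)) (mul_nonneg hb (h0 _))]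
  refine ENNReal.ofReal_le_ofReal ?_
  have h1 := (M.convex (Y ω)).convexOn.2 (mem_univ (q ω)) (mem_univ (q' ω)) ha hb hab
  simp only [smul_eq_mul] at h1
  have h2 : a * (ℓ (Y ω) (q ω) - ⨅ u : ℝ, ℓ (Y ω) u) + b * (ℓ (Y ω) (q' ω) - ⨅ u : ℝ, ℓ (Y ω) u)
      = a * ℓ (Y ω) (q ω) + b * ℓ (Y ω) (q' ω) - (a + b) * ⨅ u : ℝ, ℓ (Y ω) u := by ring
  rw [h2, hab]
  linarith

theorem convex_excessRisk_le (c : ENNReal) :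
    Convex ℝ {q : Lp ℝ 2 P | excessRisk P ℓ Y q ≤ c} := by
  intro q hq q' hq' a b ha hb hab
  have e : (a • q + b • q' : Lp ℝ 2 P) =ᵐ[P] fun ω => a * q ω + b * q' ω := by
    filter_upwards [Lp.coeFn_add (a • q) (b • q'), Lp.coeFn_smul a q, Lp.coeFn_smul b q']
      with ω h1 h2 h3
    rw [h1, Pi.add_apply, h2, h3]
    simp
  simp only [mem_ofPred_eq] at hq hq' ⊢
  rw [excessRisk_congr e]
  refine (M.excessRisk_comb_le (Lp.aestronglyMeasurable q) ha hb hab).trans ?_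
  calc _ ≤ ENNReal.ofReal a * c + ENNReal.ofReal b * c := by gcongr
    _ = c := by rw [← add_mul, ← ENNReal.ofReal_add ha hb, hab, ENNReal.ofReal_one, one_mul]

/-- Linear growth of the loss bounds the excess in `L¹` only, yet this suffices to make it vanish
after division by a norm tending to infinity. -/
theorem exists_eLpNorm_excess_le {K : ENNReal} (hK : K ≠ ⊤) :
    ∃ K' : ENNReal, K' ≠ ⊤ ∧ ∀ q : Ω → ℝ, AEStronglyMeasurable q P → excessRisk P ℓ Y q ≤ K →
      eLpNorm (fun ω => excess ℓ (Y ω) (q ω)) 1 P ≤ K' := by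
  obtain ⟨b, hb, D, hD, hgr⟩ := M.growth
  refine ⟨ENNReal.ofReal b * (K + ∫⁻ ω, ENNReal.ofReal ((⨅ u : ℝ, ℓ (Y ω) u) + D ω) ∂P),
    ENNReal.mul_ne_top ENNReal.ofReal_ne_top
      (ENNReal.add_ne_top.2 ⟨hK, (M.integrable_inf.add hD).lintegral_lt_top.ne⟩),
    fun q hq hr => ?_⟩
  rw [eLpNorm_one_eq_lintegral_enorm]
  calc ∫⁻ ω, ‖excess ℓ (Y ω) (q ω)‖ₑ ∂P
      ≤ ∫⁻ ω, ENNReal.ofReal b * (ENNReal.ofReal (ℓ (Y ω) (q ω) - ⨅ u : ℝ, ℓ (Y ω) u)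
          + ENNReal.ofReal ((⨅ u : ℝ, ℓ (Y ω) u) + D ω)) ∂P := by
        refine lintegral_mono_ae ?_
        filter_upwards [hgr] with ω hω
        rw [Real.enorm_eq_ofReal_abs]
        refine (ENNReal.ofReal_le_ofReal (hω (q ω))).trans ?_
        rw [ENNReal.ofReal_mul hb.le]
        gcongr
        refine le_trans (le_of_eq ?_) ENNReal.ofReal_add_le
        congr 1
        ring
    _ = ENNReal.ofReal b * (excessRisk P ℓ Y q
          + ∫⁻ ω, ENNReal.ofReal ((⨅ u : ℝ, ℓ (Y ω) u) + D ω) ∂P) := by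
        rw [lintegral_const_mul' _ _ ENNReal.ofReal_ne_top,
          lintegral_add_left' (M.aemeasurable_excessLoss hq)]
        rfl
    _ ≤ _ := by gcongr

theorem norm_sq_comb_sub_eq (t τ : ℝ) (x : Lp ℝ 2 P) :
    ‖t • M.memLp_U.toLp U + τ • M.memLp_G.toLp G - x‖ ^ 2
      = ∫ ω, (t * U ω + τ * G ω - x ω) ^ 2 ∂P := by
  have e : t • M.memLp_U.toLp U + τ • M.memLp_G.toLp G - x
      = ((M.memLp_comb t τ).sub (Lp.memLp x)).toLp _ := by
    conv_lhs => rw [← Lp.toLp_coeFn x (Lp.memLp x)]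
    rfl
  rw [e, norm_toLp_sq_eq_integral]
  rfl

/-- Fatou's lemma for the distance to the recession cone along a sequence of predictions of
vanishing excess. -/
theorem integral_excess_sq_le_of_tendsto {c : ℝ} {x : ℕ → Lp ℝ 2 P}
    {t τ : ℕ → ℝ} {t₀ τ₀ : ℝ} (ht : Tendsto t atTop (nhds t₀)) (hτ : Tendsto τ atTop (nhds τ₀))
    (hx : ∀ᵐ ω ∂P, Tendsto (fun n => excess ℓ (Y ω) (x n ω)) atTop (nhds 0))
    (hle : ∀ n, ‖t n • M.memLp_U.toLp U + τ n • M.memLp_G.toLp G - x n‖ ≤ c * τ n) :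
    ∫ ω, excess ℓ (Y ω) (t₀ * U ω + τ₀ * G ω) ^ 2 ∂P ≤ c ^ 2 * τ₀ ^ 2 := by
  have hE := (M.memLp_excess (M.memLp_comb t₀ τ₀)).integrable_sq
  -- The truncation at zero keeps the square monotone: by the Lipschitz property the truncated
  -- difference is at most the distance between the combination and `x n`.
  have hmeas : ∀ n, AEMeasurable (fun ω => ENNReal.ofReal
      (max (|excess ℓ (Y ω) (t n * U ω + τ n * G ω)| - |excess ℓ (Y ω) (x n ω)|) 0 ^ 2)) P := by
    intro n
    have h1 := (M.aestronglyMeasurable_excess (M.memLp_comb (t n) (τ n)).1).aemeasurable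
    have h2 := (M.aestronglyMeasurable_excess (Lp.aestronglyMeasurable (x n))).aemeasurable
    exact (((h1.abs.sub h2.abs).max aemeasurable_const).pow_const 2).ennreal_ofReal
  have hbound : ∀ n, ∫⁻ ω, ENNReal.ofReal
      (max (|excess ℓ (Y ω) (t n * U ω + τ n * G ω)| - |excess ℓ (Y ω) (x n ω)|) 0 ^ 2) ∂P
        ≤ ENNReal.ofReal ((c * τ n) ^ 2) := by
    intro n
    have h1 := pow_le_pow_left₀ (norm_nonneg _) (hle n) 2
    rw [M.norm_sq_comb_sub_eq] at h1
    refine le_trans ?_ (ENNReal.ofReal_le_ofReal h1)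
    have hI : Integrable (fun ω => (t n * U ω + τ n * G ω - x n ω) ^ 2) P :=
      ((M.memLp_comb (t n) (τ n)).sub (Lp.memLp (x n))).integrable_sq
    rw [ofReal_integral_eq_lintegral_ofReal hI (Eventually.of_forall fun ω => sq_nonneg _)]
    refine lintegral_mono fun ω => ENNReal.ofReal_le_ofReal ?_
    rw [← sq_abs (_ - _)]
    refine pow_le_pow_left₀ (le_max_right _ _) (max_le ?_ (abs_nonneg _)) 2
    have h2 := abs_excess_sub_excess_le (ℓ := ℓ) (Y ω) (t n * U ω + τ n * G ω) (x n ω)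
    exact (abs_sub_abs_le_abs_sub _ _).trans h2
  have hfatou := lintegral_liminf_le' (μ := P) (u := atTop) hmeas
  have hlhs : ∫⁻ ω, ENNReal.ofReal (excess ℓ (Y ω) (t₀ * U ω + τ₀ * G ω) ^ 2) ∂P
      ≤ ∫⁻ ω, liminf (fun n => ENNReal.ofReal
      (max (|excess ℓ (Y ω) (t n * U ω + τ n * G ω)| - |excess ℓ (Y ω) (x n ω)|) 0 ^ 2))
        atTop ∂P := by
    refine lintegral_mono_ae ?_
    filter_upwards [hx] with ω hω
    have h1 : Tendsto (fun n => excess ℓ (Y ω) (t n * U ω + τ n * G ω)) atTop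
        (nhds (excess ℓ (Y ω) (t₀ * U ω + τ₀ * G ω))) :=
      ((continuous_excess (Y ω)).tendsto _).comp ((ht.mul_const _).add (hτ.mul_const _))
    have h2 := ((h1.abs.sub hω.abs).max (tendsto_const_nhds (x := (0 : ℝ)))).pow 2
    rw [abs_zero, sub_zero, max_eq_left (abs_nonneg _), sq_abs] at h2
    exact ((ENNReal.continuous_ofReal.tendsto _).comp h2).liminf_eq.ge
  have hrhs : liminf (fun n => ∫⁻ ω, ENNReal.ofReal
      (max (|excess ℓ (Y ω) (t n * U ω + τ n * G ω)| - |excess ℓ (Y ω) (x n ω)|) 0 ^ 2) ∂P) atTop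
        ≤ ENNReal.ofReal ((c * τ₀) ^ 2) := by
    refine (liminf_le_liminf (Eventually.of_forall hbound)).trans ?_
    exact ((ENNReal.continuous_ofReal.tendsto _).comp ((hτ.const_mul c).pow 2)).liminf_eq.le
  have := hlhs.trans (hfatou.trans hrhs)
  rw [← ofReal_integral_eq_lintegral_ofReal hE (Eventually.of_forall fun ω => sq_nonneg _),
    ENNReal.ofReal_le_ofReal_iff (sq_nonneg _), mul_pow] at this
  exact this

/-- Above the threshold, the cone of feasible directions meets the recession cone trivially. -/
theorem eq_zero_of_integral_excess_sq_le {c t τ : ℝ} (hτ : 0 ≤ τ)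
    (hphi : c ^ 2 < ⨅ s, phi ℓ P U G Y s)
    (h : ∫ ω, excess ℓ (Y ω) (t * U ω + τ * G ω) ^ 2 ∂P ≤ c ^ 2 * τ ^ 2) : t = 0 ∧ τ = 0 := by
  rcases hτ.eq_or_lt with rfl | hpos
  -- With τ = 0 only the direction `U` remains, which non-triviality excludes; for τ > 0,
  -- homogeneity reduces the claim to φ(t / τ).
  · obtain ⟨C, hC, hCle⟩ := M.exists_mul_sq_le_integral_excess
    simp only [zero_mul, add_zero] at h
    have := (hCle t).trans h
    refine ⟨?_, rfl⟩
    have h2 : C * t ^ 2 ≤ 0 := by linarith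
    have h3 : t ^ 2 ≤ 0 := by nlinarith
    exact pow_eq_zero_iff two_ne_zero |>.1 (le_antisymm h3 (sq_nonneg t))
  · exfalso
    have e : ∀ ω, excess ℓ (Y ω) (t * U ω + τ * G ω) ^ 2
        = τ ^ 2 * excess ℓ (Y ω) (t / τ * U ω + 1 * G ω) ^ 2 := by
      intro ω
      rw [← mul_pow, ← excess_mul hτ]
      congr 2
      field_simp
    simp only [e] at h
    rw [integral_const_mul, ← M.phi_eq, mul_comm] at h
    have h2 := le_of_mul_le_mul_right h (by positivity)
    exact absurd (ciInf_le M.bddBelow_phi (t / τ)) (not_le.2 (h2.trans_lt hphi))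

open scoped RealInnerProductSpace

/-- Recession argument: along normalized predictions of unbounded norm the excess vanishes in the
limit, so the limiting coefficients (t₀, τ₀) satisfy the inequality that the threshold forbids
unless both are zero. -/
theorem exists_norm_le_of_excessRisk_le [IsProbabilityMeasure P] {c : ℝ} (hc : 0 < c)
    (hc1 : c < 1) (hphi : c ^ 2 < ⨅ s, phi ℓ P U G Y s) {K : ENNReal} (hK : K ≠ ⊤) :
    ∃ R : ℝ, ∀ q ∈ ballCone (M.memLp_U.toLp U) (M.memLp_G.toLp G) c,
      excessRisk P ℓ Y q ≤ K → ‖q‖ ≤ R := by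
  by_contra! hcon
  choose q hqC hqK hqn using fun n : ℕ => hcon (n + 1)
  obtain ⟨K', hK', hle⟩ := M.exists_eLpNorm_excess_le hK
  set x : ℕ → Lp ℝ 2 P := fun n => ‖q n‖⁻¹ • q n with hx
  have hqpos : ∀ n, 0 < ‖q n‖ := fun n => lt_of_le_of_lt (by positivity) (hqn n)
  have hxnorm : ∀ n, ‖x n‖ = 1 := fun n => norm_smul_inv_norm (𝕜 := ℝ) (norm_pos_iff.1 (hqpos n))
  have hxC : ∀ n, ∃ t τ : ℝ, 0 ≤ τ ∧
      ‖t • M.memLp_U.toLp U + τ • M.memLp_G.toLp G - x n‖ ≤ c * τ := by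
    intro n
    obtain ⟨t, τ, hτ, h⟩ := hqC n
    refine ⟨‖q n‖⁻¹ * t, ‖q n‖⁻¹ * τ, by positivity, ?_⟩
    have e : (‖q n‖⁻¹ * t) • M.memLp_U.toLp U + (‖q n‖⁻¹ * τ) • M.memLp_G.toLp G - x n
        = ‖q n‖⁻¹ • (t • M.memLp_U.toLp U + τ • M.memLp_G.toLp G - q n) := by
      simp only [hx]
      module
    rw [e, norm_smul, norm_inv, norm_norm, mul_left_comm]
    exact mul_le_mul_of_nonneg_left h (by positivity)
  choose t τ hτ0 htτ using hxC
  -- Since `c < 1`, this bound confines both coefficients to a compact set.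
  have hw : ∀ n, ‖t n • M.memLp_U.toLp U + τ n • M.memLp_G.toLp G‖ ≤ 1 + c * τ n := by
    intro n
    have := norm_le_norm_add_norm_sub' (t n • M.memLp_U.toLp U + τ n • M.memLp_G.toLp G) (x n)
    rw [hxnorm] at this
    linarith [htτ n]
  have hwsq : ∀ n, t n ^ 2 + τ n ^ 2 ≤ (1 + c * τ n) ^ 2 := by
    intro n
    have h1 := pow_le_pow_left₀ (norm_nonneg _) (hw n) 2
    have h2 := norm_sq_comb_sub M.norm_toLp_U M.norm_toLp_G M.inner_toLp_U_G (t n) (τ n) 0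
    simp only [sub_zero, inner_zero_right, mul_zero, norm_zero] at h2
    rw [h2] at h1
    linarith
  have hτle : ∀ n, τ n ≤ 1 / (1 - c) := by
    intro n
    have h1 : τ n ≤ 1 + c * τ n :=
      le_of_sq_le_sq (by nlinarith [hwsq n, sq_nonneg (t n)]) (by have := hτ0 n; positivity)
    rw [le_div_iff₀ (by linarith)]
    linarith
  have htle : ∀ n, |t n| ≤ 1 / (1 - c) := by
    intro n
    have h1 : |t n| ≤ 1 + c * τ n :=
      le_of_sq_le_sq (by rw [sq_abs]; nlinarith [hwsq n, sq_nonneg (τ n)])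
        (by have := hτ0 n; positivity)
    refine h1.trans ?_
    have h2 := mul_le_mul_of_nonneg_left (hτle n) hc.le
    have h3 : 1 + c * (1 / (1 - c)) = 1 / (1 - c) := by
      have : (1 - c) ≠ 0 := by linarith
      field_simp
      ring
    linarith
  have hx0 : TendstoInMeasure P (fun n ω => excess ℓ (Y ω) (x n ω)) atTop (fun _ => (0 : ℝ)) := by
    refine tendstoInMeasure_of_tendsto_eLpNorm (p := 1) one_ne_zero
      (fun n => M.aestronglyMeasurable_excess (Lp.aestronglyMeasurable _))
      aestronglyMeasurable_const ?_
    have hb : ∀ n, eLpNorm ((fun ω => excess ℓ (Y ω) (x n ω)) - fun _ => (0 : ℝ)) 1 P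
        ≤ ENNReal.ofReal (1 / ((n : ℝ) + 1)) * K' := by
      intro n
      have e : ((fun ω => excess ℓ (Y ω) (x n ω)) - fun _ => (0 : ℝ))
          =ᵐ[P] ‖q n‖⁻¹ • fun ω => excess ℓ (Y ω) (q n ω) := by
        filter_upwards [Lp.coeFn_smul ‖q n‖⁻¹ (q n)] with ω hω
        simp only [Pi.sub_apply, sub_zero, Pi.smul_apply, smul_eq_mul]
        rw [← excess_mul (by positivity), hx, hω]
        rfl
      rw [eLpNorm_congr_ae e, eLpNorm_const_smul, Real.enorm_of_nonneg (by positivity)]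
      refine mul_le_mul' (ENNReal.ofReal_le_ofReal ?_)
        (hle _ (Lp.aestronglyMeasurable _) (hqK n))
      rw [← one_div]
      exact one_div_le_one_div_of_le (by positivity) (hqn n).le
    have hlim : Tendsto (fun n : ℕ => ENNReal.ofReal (1 / ((n : ℝ) + 1)) * K') atTop (nhds 0) := by
      have h1 := (ENNReal.continuous_ofReal.tendsto 0).comp
        (tendsto_one_div_add_atTop_nhds_zero_nat (𝕜 := ℝ))
      have h2 := ENNReal.Tendsto.mul_const (b := K') h1 (Or.inr hK')
      simpa using h2
    exact tendsto_of_tendsto_of_tendsto_of_le_of_le tendsto_const_nhds hlim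
      (fun _ => zero_le) hb
  obtain ⟨ns, hns, hae⟩ := hx0.exists_seq_tendsto_ae
  obtain ⟨⟨t₀, τ₀⟩, -, φ, hφ, hlim⟩ := (isCompact_Icc.prod isCompact_Icc).tendsto_subseq
    (x := fun n => (t (ns n), τ (ns n)))
    (s := Icc (-(1 / (1 - c))) (1 / (1 - c)) ×ˢ Icc 0 (1 / (1 - c)))
    (fun n => ⟨abs_le.1 (htle _), hτ0 _, hτle _⟩)
  have hlt : Tendsto (fun n => t (ns (φ n))) atTop (nhds t₀) :=
    (continuous_fst.tendsto _).comp hlim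
  have hlτ : Tendsto (fun n => τ (ns (φ n))) atTop (nhds τ₀) :=
    (continuous_snd.tendsto _).comp hlim
  have hτ₀ : 0 ≤ τ₀ := ge_of_tendsto' hlτ fun n => hτ0 _
  have hineq := M.integral_excess_sq_le_of_tendsto (x := fun n => x (ns (φ n))) hlt hlτ
    (by filter_upwards [hae] with ω hω using hω.comp hφ.tendsto_atTop) (fun n => htτ _)
  obtain ⟨rfl, rfl⟩ := M.eq_zero_of_integral_excess_sq_le hτ₀ hphi hineq
  -- The unit vector `x n` lies within `c * τ n` of a combination whose coefficients now tend to
  -- zero.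
  have hbd : ∀ n, 1 ≤ |t (ns (φ n))| + τ (ns (φ n)) + c * τ (ns (φ n)) := by
    intro n
    set m := ns (φ n)
    have h1 := norm_le_norm_add_norm_sub (t m • M.memLp_U.toLp U + τ m • M.memLp_G.toLp G) (x m)
    have h2 := norm_add_le (t m • M.memLp_U.toLp U) (τ m • M.memLp_G.toLp G)
    rw [norm_smul, norm_smul, M.norm_toLp_U, M.norm_toLp_G, Real.norm_eq_abs, Real.norm_eq_abs,
      abs_of_nonneg (hτ0 m)] at h2
    rw [hxnorm] at h1
    linarith [htτ m]
  have hfin := (hlt.abs.add hlτ).add (hlτ.const_mul c)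
  have := ge_of_tendsto' hfin hbd
  simp at this
  linarith

/-- The variable `G` lies in the cone and has finite risk, so its sublevel set is the bounded one
required. -/
theorem exists_minimizer [IsProbabilityMeasure P] {c : ℝ} (hc : 0 < c)
    (hc1 : c < 1) (hphi : c ^ 2 < ⨅ s, phi ℓ P U G Y s) :
    ∃ q ∈ ballCone (M.memLp_U.toLp U) (M.memLp_G.toLp G) c, excessRisk P ℓ Y q ≠ ⊤ ∧
      ∀ h ∈ ballCone (M.memLp_U.toLp U) (M.memLp_G.toLp G) c,
        excessRisk P ℓ Y q ≤ excessRisk P ℓ Y h := by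
  have hgC : M.memLp_G.toLp G ∈ ballCone (M.memLp_U.toLp U) (M.memLp_G.toLp G) c :=
    ⟨0, 1, zero_le_one, by simpa using hc.le⟩
  have hgr : excessRisk P ℓ Y (M.memLp_G.toLp G) ≠ ⊤ := by
    rw [excessRisk_congr M.memLp_G.coeFn_toLp]
    exact M.excessRisk_gauss_ne_top
  obtain ⟨R, hR⟩ := M.exists_norm_le_of_excessRisk_le hc hc1 hphi hgr
  obtain ⟨q, hqC, hq⟩ := exists_forall_le_of_bounded_sublevel
    (C := ballCone (M.memLp_U.toLp U) (M.memLp_G.toLp G) c)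
    (F := fun q : Lp ℝ 2 P => excessRisk P ℓ Y q)
    (fun k => (isClosed_ballCone M.norm_toLp_U M.norm_toLp_G M.inner_toLp_U_G hc hc1).inter
      (M.isClosed_excessRisk_le k))
    (fun k => convex_ballCone.inter (M.convex_excessRisk_le k)) hgC hR
  exact ⟨q, hqC, ne_top_of_le_ne_top hgr (hq _ hgC), hq⟩

end IsLossModel

/-! ### Feasible directions at a point of the cone. -/

section Hilbert

open scoped RealInnerProductSpace

variable {H : Type*} [NormedAddCommGroup H] [InnerProductSpace ℝ H]

/-- The quadratic form whose nonpositivity defines `ballCone u g c` in the half space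
`0 ≤ ⟪g, d⟫`. -/
noncomputable def coneForm (u g : H) (c : ℝ) (d : H) : ℝ :=
  ‖d‖ ^ 2 - ⟪u, d⟫ ^ 2 - ⟪g, d⟫ ^ 2 / (1 - c ^ 2)

/-- Minus half the gradient of `coneForm`. -/
noncomputable def coneResidual (u g : H) (c : ℝ) (d : H) : H :=
  ⟪u, d⟫ • u + (⟪g, d⟫ / (1 - c ^ 2)) • g - d

variable {u g : H} {c : ℝ}

/-- On the boundary, where the form vanishes, this is the first equation of the system, with σ = ⟪g,
d⟫ / (1 - c²). -/
theorem norm_sq_coneResidual (hu : ‖u‖ = 1) (hg : ‖g‖ = 1) (hug : ⟪u, g⟫ = 0)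
    (hc : 1 - c ^ 2 ≠ 0) (d : H) :
    ‖coneResidual u g c d‖ ^ 2 = coneForm u g c d + c ^ 2 * (⟪g, d⟫ / (1 - c ^ 2)) ^ 2 := by
  rw [coneResidual, norm_sq_comb_sub hu hg hug, coneForm]
  field_simp
  ring

theorem coneForm_add_smul (q d : H) (η : ℝ) :
    coneForm u g c (q + η • d)
      = coneForm u g c q - 2 * η * ⟪coneResidual u g c q, d⟫ + η ^ 2 * coneForm u g c d := by
  rw [coneForm, coneForm, coneForm, coneResidual, norm_add_sq_real, norm_smul, inner_sub_left,
    inner_add_left, inner_smul_left, inner_smul_left, inner_add_right, inner_add_right,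
    inner_smul_right, inner_smul_right, inner_smul_right, mul_pow, Real.norm_eq_abs, sq_abs]
  simp only [conj_trivial]
  ring

/-- The half-space condition is open at `q`. The form has slope -2⟪residual, d⟫ along `d`, so at a
boundary point a positive pairing makes it negative for small η > 0. -/
theorem eventually_add_smul_mem_ballCone (hu : ‖u‖ = 1) (hg : ‖g‖ = 1) (hug : ⟪u, g⟫ = 0)
    (hc : 0 < c) (hc1 : c < 1) {q d : H} (hq : 0 < ⟪g, q⟫)
    (h : coneForm u g c q < 0 ∨ coneForm u g c q ≤ 0 ∧ 0 < ⟪coneResidual u g c q, d⟫) :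
    ∀ᶠ η in nhdsWithin (0 : ℝ) (Ioi 0), q + η • d ∈ ballCone u g c := by
  have h1 : ∀ᶠ η in nhdsWithin (0 : ℝ) (Ioi 0), 0 < ⟪g, q + η • d⟫ := by
    have hcont : Continuous fun η : ℝ => ⟪g, q + η • d⟫ := by fun_prop
    have := hcont.tendsto 0
    simp only [zero_smul, add_zero] at this
    exact (this.eventually_const_lt hq).filter_mono nhdsWithin_le_nhds
  have h2 : ∀ᶠ η in nhdsWithin (0 : ℝ) (Ioi 0), coneForm u g c (q + η • d) ≤ 0 := by
    simp only [coneForm_add_smul]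
    rcases h with h | ⟨h, h'⟩
    · have hcont : Continuous fun η : ℝ => coneForm u g c q
          - 2 * η * ⟪coneResidual u g c q, d⟫ + η ^ 2 * coneForm u g c d := by fun_prop
      have := hcont.tendsto 0
      simp only [mul_zero, zero_mul, sub_zero, ne_eq, OfNat.ofNat_ne_zero, not_false_eq_true,
        zero_pow, add_zero] at this
      exact ((this.eventually_lt_const h).filter_mono nhdsWithin_le_nhds).mono fun _ h => h.le
    · have hcont : Continuous fun η : ℝ =>
          - 2 * ⟪coneResidual u g c q, d⟫ + η * coneForm u g c d := by fun_prop
      have := hcont.tendsto 0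
      simp only [zero_mul, add_zero] at this
      have hlt := (this.eventually_lt_const (u := 0) (by linarith)).filter_mono
        (nhdsWithin_le_nhds (s := Ioi 0))
      filter_upwards [hlt, self_mem_nhdsWithin] with η hη hpos
      have := mul_neg_of_pos_of_neg (mem_Ioi.1 hpos) hη
      nlinarith
  filter_upwards [h1, h2] with η h1 h2
  exact (mem_ballCone_iff hu hg hug hc hc1).2 ⟨h1.le, h2⟩

end Hilbert

/-! ### Test functions and first-order conditions for the excess risk. -/

/-- Bounded perturbations of `q` along which the expected loss is finite and differentiable. -/
structure IsTestFunction {Ω : Type*} [MeasurableSpace Ω] {𝒴 : Set ℝ} (ℓ : 𝒴 → ℝ → ℝ)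
    (Y : Ω → 𝒴) (q e : Ω → ℝ) : Prop where
  measurable : Measurable e
  bound : ∃ n : ℝ, ∀ ω, |e ω| ≤ n ∧
    (e ω ≠ 0 → |deriv (ℓ (Y ω)) (q ω + 1)| ≤ n ∧ |deriv (ℓ (Y ω)) (q ω - 1)| ≤ n)

/-- The sets, increasing to the whole space, on which test functions may live. -/
def tameSet {Ω : Type*} {𝒴 : Set ℝ} (ℓ : 𝒴 → ℝ → ℝ) (Y : Ω → 𝒴) (q f : Ω → ℝ) (n : ℝ) : Set Ω :=
  {ω | |deriv (ℓ (Y ω)) (q ω + 1)| ≤ n ∧ |deriv (ℓ (Y ω)) (q ω - 1)| ≤ n ∧ |f ω| ≤ n}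

theorem eventually_mem_tameSet {Ω : Type*} {𝒴 : Set ℝ} (ℓ : 𝒴 → ℝ → ℝ) (Y : Ω → 𝒴)
    (q f : Ω → ℝ) (ω : Ω) : ∀ᶠ n : ℕ in atTop, ω ∈ tameSet ℓ Y q f n := by
  have h : ∀ x : ℝ, ∀ᶠ n : ℕ in atTop, x ≤ n := fun x =>
    tendsto_natCast_atTop_atTop.eventually_ge_atTop x
  filter_upwards [h |deriv (ℓ (Y ω)) (q ω + 1)|, h |deriv (ℓ (Y ω)) (q ω - 1)|, h |f ω|]
    with n h1 h2 h3
  exact ⟨h1, h2, h3⟩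

/-- The tame sets exhaust the space, so vanishing on all large ones is enough. -/
theorem ae_eq_zero_of_eventually_integral_tameSet_le {Ω : Type*} [MeasurableSpace Ω]
    {P : Measure Ω} {𝒴 : Set ℝ} (ℓ : 𝒴 → ℝ → ℝ) (Y : Ω → 𝒴) (q f : Ω → ℝ) {p : Ω → ℝ}
    (h : ∀ᶠ n : ℕ in atTop, Integrable ((tameSet ℓ Y q f n).indicator fun ω => p ω ^ 2) P ∧
      ∫ ω, (tameSet ℓ Y q f n).indicator (fun ω => p ω ^ 2) ω ∂P ≤ 0) :
    ∀ᵐ ω ∂P, p ω = 0 := by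
  obtain ⟨N, hN⟩ := eventually_atTop.1 h
  have hae : ∀ n : ℕ, N ≤ n → ∀ᵐ ω ∂P, ω ∈ tameSet ℓ Y q f n → p ω = 0 := by
    intro n hn
    obtain ⟨hi, hle⟩ := hN n hn
    have h0 : ∀ ω, 0 ≤ (tameSet ℓ Y q f n).indicator (fun ω => p ω ^ 2) ω := fun ω =>
      indicator_nonneg (fun _ _ => sq_nonneg _) ω
    have h1 := (integral_eq_zero_iff_of_nonneg h0 hi).1 (le_antisymm hle (integral_nonneg h0))
    filter_upwards [h1] with ω hω hmem
    rw [indicator_of_mem hmem] at hω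
    exact pow_eq_zero_iff two_ne_zero |>.1 hω
  have hall : ∀ᵐ ω ∂P, ∀ n : ℕ, N ≤ n → ω ∈ tameSet ℓ Y q f n → p ω = 0 := by
    rw [ae_all_iff]
    intro n
    by_cases hn : N ≤ n
    · filter_upwards [hae n hn] with ω hω _ using hω
    · exact Eventually.of_forall fun ω h => absurd h hn
  filter_upwards [hall] with ω hω
  obtain ⟨n, hn1, hn2⟩ := ((eventually_mem_tameSet ℓ Y q f ω).and (eventually_ge_atTop N)).exists
  exact hω n hn2 hn1

namespace IsTestFunction

variable {Ω : Type*} [MeasurableSpace Ω] {P : Measure Ω} [IsProbabilityMeasure P] {𝒴 : Set ℝ}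
  {ℓ : 𝒴 → ℝ → ℝ} {Y : Ω → 𝒴} {q e e' : Ω → ℝ}

theorem add_const_mul (h : IsTestFunction ℓ Y q e) (h' : IsTestFunction ℓ Y q e') (k : ℝ) :
    IsTestFunction ℓ Y q fun ω => e ω + k * e' ω := by
  obtain ⟨hm, n, hn⟩ := h
  obtain ⟨hm', n', hn'⟩ := h'
  refine ⟨hm.add (hm'.const_mul k), n + (|k| + 1) * n', fun ω => ?_⟩
  have h0 : 0 ≤ n := (abs_nonneg _).trans (hn ω).1
  have h0' : 0 ≤ n' := (abs_nonneg _).trans (hn' ω).1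
  have hk := mul_nonneg (abs_nonneg k) h0'
  constructor
  · refine (abs_add_le _ _).trans ?_
    rw [abs_mul]
    have := mul_le_mul_of_nonneg_left (hn' ω).1 (abs_nonneg k)
    linarith [(hn ω).1]
  · intro hne
    by_cases he : e ω = 0
    · have he' : e' ω ≠ 0 := by
        rintro he'
        simp [he, he'] at hne
      have := (hn' ω).2 he'
      exact ⟨by linarith [this.1], by linarith [this.2]⟩
    · have := (hn ω).2 he
      exact ⟨by linarith [this.1], by linarith [this.2]⟩

theorem memLp (h : IsTestFunction ℓ Y q e) : MemLp e 2 P := by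
  obtain ⟨hm, n, hn⟩ := h
  exact MemLp.of_bound hm.aestronglyMeasurable n (Eventually.of_forall fun ω => (hn ω).1)

end IsTestFunction

namespace IsLossModel

variable {Ω : Type*} [MeasurableSpace Ω] {P : Measure Ω} {𝒴 : Set ℝ}
  {ℓ : 𝒴 → ℝ → ℝ} {U G : Ω → ℝ} {Y : Ω → 𝒴} (M : IsLossModel P ℓ U G Y)
include M

/-- Monotonicity of the derivative: its values at `q ± 1` control it on the whole interval between.
-/
theorem abs_deriv_le (y : 𝒴) {q v n : ℝ} (hv : |v| ≤ 1)
    (h1 : |deriv (ℓ y) (q + 1)| ≤ n) (h2 : |deriv (ℓ y) (q - 1)| ≤ n) :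
    |deriv (ℓ y) (q + v)| ≤ n := by
  have hm := ((M.convex y).strictMono_deriv (M.differentiable y)).monotone
  obtain ⟨ha, hb⟩ := abs_le.1 hv
  have k1 := hm (show q + v ≤ q + 1 by linarith)
  have k2 := hm (show q - 1 ≤ q + v by linarith)
  exact abs_le.2 ⟨by linarith [(abs_le.1 h2).1], by linarith [(abs_le.1 h1).2]⟩

theorem integrable_deriv_mul [IsProbabilityMeasure P] {q e : Ω → ℝ} (hq : Measurable q)
    (he : IsTestFunction ℓ Y q e) : Integrable (fun ω => deriv (ℓ (Y ω)) (q ω) * e ω) P := by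
  obtain ⟨hm, n, hn⟩ := he
  refine Integrable.of_bound
    ((M.aestronglyMeasurable_deriv hq.aestronglyMeasurable).mul hm.aestronglyMeasurable) (n * n)
    (Eventually.of_forall fun ω => ?_)
  rw [norm_mul, Real.norm_eq_abs, Real.norm_eq_abs]
  by_cases h0 : e ω = 0
  · rw [h0, abs_zero, mul_zero]
    exact mul_self_nonneg n
  · have h1 := M.abs_deriv_le (Y ω) (v := 0) (by simp) ((hn ω).2 h0).1 ((hn ω).2 h0).2
    rw [add_zero] at h1
    exact mul_le_mul h1 (hn ω).1 (abs_nonneg _) ((abs_nonneg _).trans h1)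

/-- The first-order condition at a minimizer of the excess risk. -/
theorem integral_deriv_mul_nonneg [IsProbabilityMeasure P] {q e : Ω → ℝ} (hq : Measurable q)
    (hfin : excessRisk P ℓ Y q ≠ ⊤) (he : IsTestFunction ℓ Y q e)
    (hmin : ∀ᶠ η in nhdsWithin (0 : ℝ) (Ioi 0),
      excessRisk P ℓ Y q ≤ excessRisk P ℓ Y fun ω => q ω + η * e ω) :
    0 ≤ ∫ ω, deriv (ℓ (Y ω)) (q ω) * e ω ∂P := by
  obtain ⟨hm, n, hn⟩ := he
  have hL : Integrable (fun ω => ℓ (Y ω) (q ω) - ⨅ u : ℝ, ℓ (Y ω) u) P := by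
    refine ⟨(M.aestronglyMeasurable_loss hq.aestronglyMeasurable).sub M.integrable_inf.1, ?_⟩
    rw [hasFiniteIntegral_iff_ofReal]
    · exact lt_top_iff_ne_top.2 hfin
    · filter_upwards [M.bddBelow] with ω hω using sub_nonneg.2 (ciInf_le hω _)
  have hsmall : ∀ᶠ η in nhdsWithin (0 : ℝ) (Ioi 0), ∀ ω, |η * e ω| ≤ 1 := by
    have h1 : ∀ᶠ η in nhdsWithin (0 : ℝ) (Ioi 0), η * (|n| + 1) < 1 := by
      have hc : Continuous fun η : ℝ => η * (|n| + 1) := by fun_prop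
      have := hc.tendsto 0
      rw [zero_mul] at this
      exact (this.eventually_lt_const one_pos).filter_mono nhdsWithin_le_nhds
    filter_upwards [h1, self_mem_nhdsWithin] with η hη hpos ω
    rw [abs_mul, abs_of_pos (mem_Ioi.1 hpos)]
    have := mul_le_mul_of_nonneg_left (((hn ω).1.trans (le_abs_self n)).trans
      (lt_add_one |n|).le) (mem_Ioi.1 hpos).le
    linarith
  have hbound : ∀ η : ℝ, (∀ ω, |η * e ω| ≤ 1) → ∀ ω,
      ‖deriv (ℓ (Y ω)) (q ω + η * e ω) * e ω‖ ≤ n * n := by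
    intro η hη ω
    rw [norm_mul, Real.norm_eq_abs, Real.norm_eq_abs]
    by_cases h0 : e ω = 0
    · rw [h0, abs_zero, mul_zero]
      exact mul_self_nonneg n
    · have h1 := M.abs_deriv_le (Y ω) (hη ω) ((hn ω).2 h0).1 ((hn ω).2 h0).2
      exact mul_le_mul h1 (hn ω).1 (abs_nonneg _) ((abs_nonneg _).trans h1)
  have hmeas : ∀ η : ℝ,
      AEStronglyMeasurable (fun ω => deriv (ℓ (Y ω)) (q ω + η * e ω) * e ω) P := fun η =>
    (M.aestronglyMeasurable_deriv (hq.add (hm.const_mul η)).aestronglyMeasurable).mul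
      hm.aestronglyMeasurable
  have hnonneg : ∀ᶠ η in nhdsWithin (0 : ℝ) (Ioi 0),
      0 ≤ ∫ ω, deriv (ℓ (Y ω)) (q ω + η * e ω) * e ω ∂P := by
    filter_upwards [hmin, hsmall, self_mem_nhdsWithin] with η h1 h2 hpos
    have hI : Integrable (fun ω => deriv (ℓ (Y ω)) (q ω + η * e ω) * e ω) P :=
      Integrable.of_bound (hmeas η) (n * n) (Eventually.of_forall (hbound η h2))
    have hI2 : Integrable (fun ω => (ℓ (Y ω) (q ω) - ⨅ u : ℝ, ℓ (Y ω) u)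
        + η * (deriv (ℓ (Y ω)) (q ω + η * e ω) * e ω)) P := hL.add (hI.const_mul η)
    have hle : ∀ ω, ℓ (Y ω) (q ω + η * e ω) - (⨅ u : ℝ, ℓ (Y ω) u)
        ≤ (ℓ (Y ω) (q ω) - ⨅ u : ℝ, ℓ (Y ω) u)
          + η * (deriv (ℓ (Y ω)) (q ω + η * e ω) * e ω) := by
      intro ω
      -- The tangent is taken at the perturbed point, so minimality makes the integral of `deriv (ℓ
      -- (Y ω)) (q ω + η * e ω) * e ω` nonnegative for each small η; dominated convergence then lets
      -- η → 0.
      have := (M.convex (Y ω)).convexOn.tangent_le (M.differentiable _) (q ω + η * e ω) (q ω)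
      nlinarith
    have h0 : ∀ᵐ ω ∂P, 0 ≤ (ℓ (Y ω) (q ω) - ⨅ u : ℝ, ℓ (Y ω) u)
          + η * (deriv (ℓ (Y ω)) (q ω + η * e ω) * e ω) := by
      filter_upwards [M.bddBelow] with ω hω
      exact (sub_nonneg.2 (ciInf_le hω (q ω + η * e ω))).trans (hle ω)
    have h3 : excessRisk P ℓ Y q ≤ ∫⁻ ω, ENNReal.ofReal
        ((ℓ (Y ω) (q ω) - ⨅ u : ℝ, ℓ (Y ω) u)
          + η * (deriv (ℓ (Y ω)) (q ω + η * e ω) * e ω)) ∂P :=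
      h1.trans (lintegral_mono fun ω => ENNReal.ofReal_le_ofReal (hle ω))
    have hL0 : ∀ᵐ ω ∂P, 0 ≤ ℓ (Y ω) (q ω) - ⨅ u : ℝ, ℓ (Y ω) u := by
      filter_upwards [M.bddBelow] with ω hω using sub_nonneg.2 (ciInf_le hω _)
    rw [excessRisk, ← ofReal_integral_eq_lintegral_ofReal hL hL0,
      ← ofReal_integral_eq_lintegral_ofReal hI2 h0,
      ENNReal.ofReal_le_ofReal_iff (integral_nonneg_of_ae h0),
      integral_add hL (hI.const_mul η), integral_const_mul] at h3
    exact (mul_nonneg_iff_of_pos_left (mem_Ioi.1 hpos)).1 (by linarith)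
  have hlim : Tendsto (fun η : ℝ => ∫ ω, deriv (ℓ (Y ω)) (q ω + η * e ω) * e ω ∂P)
      (nhdsWithin 0 (Ioi 0)) (nhds (∫ ω, deriv (ℓ (Y ω)) (q ω) * e ω ∂P)) := by
    refine tendsto_integral_filter_of_dominated_convergence (fun _ => n * n)
      (Eventually.of_forall hmeas) ?_ (integrable_const _) ?_
    · filter_upwards [hsmall] with η hη
      exact Eventually.of_forall (hbound η hη)
    · refine Eventually.of_forall fun ω => ?_
      have hc : Continuous fun η : ℝ => deriv (ℓ (Y ω)) (q ω + η * e ω) * e ω := by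
        have := continuous_deriv_loss M.smooth (Y ω)
        fun_prop
      have := hc.tendsto 0
      rw [zero_mul, add_zero] at this
      exact this.mono_left nhdsWithin_le_nhds
  exact ge_of_tendsto hlim hnonneg

theorem measurableSet_tameSet {q f : Ω → ℝ} (hq : Measurable q) (hf : Measurable f) (n : ℝ) :
    MeasurableSet (tameSet ℓ Y q f n) := by
  have hd := measurable_deriv_loss_uncurry M.smooth M.meas
  have m1 : Measurable fun ω => deriv (ℓ (Y ω)) (q ω + 1) :=
    hd.comp (M.measurable_Y.prodMk (hq.add_const 1))
  have m2 : Measurable fun ω => deriv (ℓ (Y ω)) (q ω - 1) :=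
    hd.comp (M.measurable_Y.prodMk (hq.sub_const 1))
  exact (measurableSet_le m1.abs measurable_const).inter
    ((measurableSet_le m2.abs measurable_const).inter (measurableSet_le hf.abs measurable_const))

theorem abs_deriv_le_of_mem_tameSet {q f : Ω → ℝ} {n : ℝ} {ω : Ω}
    (hω : ω ∈ tameSet ℓ Y q f n) : |deriv (ℓ (Y ω)) (q ω)| ≤ n := by
  have h0 := M.abs_deriv_le (Y ω) (v := 0) (by simp) hω.1 hω.2.1
  rwa [add_zero] at h0

theorem isTestFunction_indicator {q f h : Ω → ℝ} (hq : Measurable q) (hf : Measurable f)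
    (hh : Measurable h) (n : ℝ) {N : ℝ}
    (hle : ∀ ω, |f ω| ≤ n → |deriv (ℓ (Y ω)) (q ω)| ≤ n → |h ω| ≤ N) :
    IsTestFunction ℓ Y q ((tameSet ℓ Y q f n).indicator h) := by
  refine ⟨hh.indicator (M.measurableSet_tameSet hq hf n), max (max N n) 0, fun ω => ?_⟩
  by_cases hω : ω ∈ tameSet ℓ Y q f n
  · rw [indicator_of_mem hω]
    exact ⟨(hle ω hω.2.2 (M.abs_deriv_le_of_mem_tameSet hω)).trans
        ((le_max_left _ _).trans (le_max_left _ _)),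
      fun _ => ⟨hω.1.trans ((le_max_right _ _).trans (le_max_left _ _)),
        hω.2.1.trans ((le_max_right _ _).trans (le_max_left _ _))⟩⟩
  · rw [indicator_of_notMem hω]
    simp

/-- A strictly convex loss with a critical point is coercive, and the loss is not almost surely
coercive. -/
theorem not_deriv_ae_eq_zero [IsProbabilityMeasure P] {q : Ω → ℝ} :
    ¬ ∀ᵐ ω ∂P, deriv (ℓ (Y ω)) (q ω) = 0 := by
  intro h
  have : ∀ᵐ ω ∂P, ω ∈ Y ⁻¹' coerciveLabels ℓ := by
    filter_upwards [h] with ω hω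
    exact (M.convex (Y ω)).coercive_of_deriv (M.differentiable _) hω.le hω.ge
  have h1 := prob_compl_eq_zero_iff
    (M.measurable_Y (measurableSet_coerciveLabels M.smooth M.convex M.meas)) |>.1 this
  exact absurd M.not_coercive (by rw [h1]; exact lt_irrefl 1)

end IsLossModel

/-! ### Existence above the threshold through Lagrange multipliers. -/

namespace IsLossModel

variable {Ω : Type*} [MeasurableSpace Ω] {P : Measure Ω} [IsProbabilityMeasure P] {𝒴 : Set ℝ}
  {ℓ : 𝒴 → ℝ → ℝ} {U G : Ω → ℝ} {Y : Ω → 𝒴} (M : IsLossModel P ℓ U G Y)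
include M

open scoped RealInnerProductSpace

/-- The first-order condition at a minimizer over the cone, for feasible directions. -/
theorem integral_deriv_mul_nonneg_of_feasible {c : ℝ} {x : Lp ℝ 2 P} {q : Ω → ℝ}
    (hq : Measurable q) (hxq : x =ᵐ[P] q) (hfin : excessRisk P ℓ Y x ≠ ⊤)
    (hmin : ∀ h ∈ ballCone (M.memLp_U.toLp U) (M.memLp_G.toLp G) c,
        excessRisk P ℓ Y x ≤ excessRisk P ℓ Y h) {e : Ω → ℝ} (he : IsTestFunction ℓ Y q e)
    (hfeas : ∀ᶠ η in nhdsWithin (0 : ℝ) (Ioi 0), x + η • (he.memLp (P := P)).toLp e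
      ∈ ballCone (M.memLp_U.toLp U) (M.memLp_G.toLp G) c) :
    0 ≤ ∫ ω, deriv (ℓ (Y ω)) (q ω) * e ω ∂P := by
  rw [excessRisk_congr hxq] at hfin
  refine M.integral_deriv_mul_nonneg hq hfin he ?_
  filter_upwards [hfeas] with η hη
  have h1 := hmin _ hη
  have e1 : (x + η • (he.memLp (P := P)).toLp e : Lp ℝ 2 P) =ᵐ[P] fun ω => q ω + η * e ω := by
    filter_upwards [Lp.coeFn_add x (η • (he.memLp (P := P)).toLp e),
      Lp.coeFn_smul η ((he.memLp (P := P)).toLp e), (he.memLp (P := P)).coeFn_toLp, hxq]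
      with ω k1 k2 k3 k4
    rw [k1, Pi.add_apply, k2, Pi.smul_apply, k3, k4, smul_eq_mul]
  rwa [excessRisk_congr hxq, excessRisk_congr e1] at h1

omit [IsProbabilityMeasure P] in
theorem tendsto_truncated_gauss (q : Ω → ℝ) (hq : Measurable q) :
    Tendsto (fun n : ℕ => ∫ ω, (G ω - (tameSet ℓ Y q 0 n).indicator
      ({ω | |G ω| ≤ n}.indicator G) ω) ^ 2 ∂P) atTop (nhds 0) := by
  have hK : ∀ n : ℕ, MeasurableSet {ω | |G ω| ≤ n} := fun n =>
    measurableSet_le M.measurable_G.abs measurable_const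
  have hS : ∀ n : ℕ, MeasurableSet (tameSet ℓ Y q 0 n) := fun n =>
    M.measurableSet_tameSet hq measurable_zero n
  have := tendsto_integral_of_dominated_convergence (μ := P)
    (F := fun (n : ℕ) ω => (G ω - (tameSet ℓ Y q 0 n).indicator
      ({ω | |G ω| ≤ n}.indicator G) ω) ^ 2) (f := fun _ => 0) (fun ω => G ω ^ 2)
    (fun n => ((M.measurable_G.sub ((M.measurable_G.indicator (hK n)).indicator (hS n))).pow_const
      2).aestronglyMeasurable) M.memLp_G.integrable_sq
    (fun n => Eventually.of_forall fun ω => by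
      rw [Real.norm_of_nonneg (sq_nonneg _)]
      simp only [indicator]
      split_ifs <;> simp [sq_nonneg])
    (Eventually.of_forall fun ω => by
      refine tendsto_const_nhds.congr' ?_
      filter_upwards [eventually_mem_tameSet ℓ Y q 0 ω,
        (tendsto_natCast_atTop_atTop (R := ℝ)).eventually_ge_atTop |G ω|] with n h1 h2
      rw [indicator_of_mem h1, indicator_of_mem (show ω ∈ {ω | |G ω| ≤ n} from h2)]
      simp)
  simpa using this

omit [IsProbabilityMeasure P] in
theorem integral_truncated_gauss (n : ℝ) : ∫ ω, {ω | |G ω| ≤ n}.indicator G ω ∂P = 0 := by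
  have hm : Measurable ({x : ℝ | |x| ≤ n}.indicator fun x : ℝ => x) :=
    measurable_id.indicator (measurableSet_le measurable_id.abs measurable_const)
  have h1 : ∫ ω, {ω | |G ω| ≤ n}.indicator G ω ∂P
      = ∫ x, {x : ℝ | |x| ≤ n}.indicator (fun x : ℝ => x) x ∂(gaussianReal 0 1) := by
    rw [← M.law_G, integral_map M.measurable_G.aemeasurable hm.aestronglyMeasurable]
    rfl
  have h2 : ∫ x, {x : ℝ | |x| ≤ n}.indicator (fun x : ℝ => x) x ∂(gaussianReal 0 1)
      -- The Gaussian law is symmetric and the truncated identity is odd.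
      = ∫ x, {x : ℝ | |x| ≤ n}.indicator (fun x : ℝ => x) (-x) ∂(gaussianReal 0 1) := by
    have := integral_map (μ := gaussianReal 0 1) (φ := fun x : ℝ => -x) (by fun_prop)
      hm.aestronglyMeasurable
    rwa [gaussianReal_map_neg, neg_zero] at this
  have h3 : ∀ x : ℝ, {x : ℝ | |x| ≤ n}.indicator (fun x : ℝ => x) (-x)
      = -{x : ℝ | |x| ≤ n}.indicator (fun x : ℝ => x) x := by
    intro x
    simp only [indicator, mem_ofPred_eq, abs_neg]
    split_ifs <;> simp
  simp only [h3] at h2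
  rw [integral_neg] at h2
  rw [h1]
  linarith

omit [IsProbabilityMeasure P] in
/-- Independence of `G` and `(U, Y)` for the score at a multiple of `U`. -/
theorem integral_score_mul_truncated_gauss (a : ℝ) (n : ℝ) :
    ∫ ω, (tameSet ℓ Y (fun ω => a * U ω) 0 n).indicator
      (fun ω => deriv (ℓ (Y ω)) (a * U ω)) ω * {ω | |G ω| ≤ n}.indicator G ω ∂P = 0 := by
  have hd := measurable_deriv_loss_uncurry M.smooth M.meas
  have hgm : Measurable ({x : ℝ | |x| ≤ n}.indicator fun x : ℝ => x) :=
    measurable_id.indicator (measurableSet_le measurable_id.abs measurable_const)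
  have k : ∀ v : ℝ, Measurable fun p : ℝ × 𝒴 => deriv (ℓ p.2) (a * p.1 + v) := fun v =>
    hd.comp (measurable_snd.prodMk ((measurable_fst.const_mul a).add_const v))
  have k0 : Measurable fun p : ℝ × 𝒴 => deriv (ℓ p.2) (a * p.1) := by simpa using k 0
  have kn : Measurable fun p : ℝ × 𝒴 => deriv (ℓ p.2) (a * p.1 - 1) := by
    simpa [sub_eq_add_neg] using k (-1)
  -- The tame set is rebuilt on the product space: it depends on (U, Y) alone, as independence
  -- requires.
  have hsm : Measurable ((tameSet ℓ Prod.snd (fun p : ℝ × 𝒴 => a * p.1) 0 n).indicator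
      (fun p : ℝ × 𝒴 => deriv (ℓ p.2) (a * p.1))) := by
    refine k0.indicator ?_
    exact (measurableSet_le (k 1).abs measurable_const).inter
      ((measurableSet_le kn.abs measurable_const).inter
        (show MeasurableSet {p : ℝ × 𝒴 | |(0 : ℝ × 𝒴 → ℝ) p| ≤ n} from
          measurableSet_le measurable_zero.abs measurable_const))
  have hind := (M.indep.comp hgm hsm).symm
  have := hind.integral_fun_mul_eq_mul_integral
    (hsm.comp (M.measurable_U.prodMk M.measurable_Y)).aestronglyMeasurable
    (hgm.comp M.measurable_G).aestronglyMeasurable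
  have e : ∫ ω, ({x : ℝ | |x| ≤ n}.indicator fun x : ℝ => x) (G ω) ∂P = 0 :=
    M.integral_truncated_gauss n
  simp only [Function.comp_def] at this
  rw [e, mul_zero] at this
  exact this

/-- A minimizer is not a multiple of `U`. -/
theorem inner_G_pos_of_minimizer {c : ℝ} (hc : 0 < c) (hc1 : c < 1) {x : Lp ℝ 2 P}
    (hx : x ∈ ballCone (M.memLp_U.toLp U) (M.memLp_G.toLp G) c)
    (hfin : excessRisk P ℓ Y x ≠ ⊤)
    (hmin : ∀ h ∈ ballCone (M.memLp_U.toLp U) (M.memLp_G.toLp G) c,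
        excessRisk P ℓ Y x ≤ excessRisk P ℓ Y h) : 0 < ⟪M.memLp_G.toLp G, x⟫ := by
  have hk : 1 - c ^ 2 ≠ 0 := by nlinarith
  obtain ⟨h0, hQ⟩ := (mem_ballCone_iff M.norm_toLp_U M.norm_toLp_G M.inner_toLp_U_G hc hc1).1 hx
  refine lt_of_le_of_ne h0 fun hz => ?_
  set a := ⟪M.memLp_U.toLp U, x⟫ with ha
  -- With ⟪G, x⟫ = 0, membership in the cone makes the residual vanish, which leaves only the `U`
  -- component.
  have hxa : x = a • M.memLp_U.toLp U := by
    have h1 := norm_sq_coneResidual M.norm_toLp_U M.norm_toLp_G M.inner_toLp_U_G hk x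
    rw [← hz, zero_div, zero_pow two_ne_zero, mul_zero, add_zero] at h1
    have h2 : ‖coneResidual (M.memLp_U.toLp U) (M.memLp_G.toLp G) c x‖ ^ 2 ≤ 0 := h1.le.trans hQ
    have h3 := norm_eq_zero.1 (pow_eq_zero_iff two_ne_zero |>.1 (le_antisymm h2 (sq_nonneg _)))
    rw [coneResidual, ← hz, zero_div, zero_smul, add_zero] at h3
    exact (sub_eq_zero.1 h3).symm
  set q : Ω → ℝ := fun ω => a * U ω with hq
  have hqm : Measurable q := M.measurable_U.const_mul a
  have hxq : x =ᵐ[P] q := by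
    have := (M.memLp_U.const_mul a).coeFn_toLp
    rw [hxa]
    exact this
  have hsm : Measurable fun ω => deriv (ℓ (Y ω)) (q ω) :=
    (measurable_deriv_loss_uncurry M.smooth M.meas).comp (M.measurable_Y.prodMk hqm)
  refine M.not_deriv_ae_eq_zero (q := q)
    (ae_eq_zero_of_eventually_integral_tameSet_le ℓ Y q 0 ?_)
  filter_upwards [(M.tendsto_truncated_gauss q hqm).eventually_lt_const
    (show 0 < (c / 2) ^ 2 by positivity)] with n hn
  have ht1 : IsTestFunction ℓ Y q ((tameSet ℓ Y q 0 n).indicator ({ω | |G ω| ≤ n}.indicator G)) :=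
    M.isTestFunction_indicator hqm measurable_zero (M.measurable_G.indicator
      (measurableSet_le M.measurable_G.abs measurable_const)) n (N := n) fun ω _ _ => by
        by_cases hω : |G ω| ≤ n
        · rwa [indicator_of_mem (show ω ∈ {ω | |G ω| ≤ n} from hω)]
        · rw [indicator_of_notMem (show ω ∉ {ω | |G ω| ≤ n} from hω), abs_zero]
          exact Nat.cast_nonneg n
  have ht2 : IsTestFunction ℓ Y q ((tameSet ℓ Y q 0 n).indicator
      fun ω => deriv (ℓ (Y ω)) (q ω)) :=
    M.isTestFunction_indicator hqm measurable_zero hsm n (N := n) fun ω _ h => h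
  have e2 : ∀ ω, deriv (ℓ (Y ω)) (q ω) * (tameSet ℓ Y q 0 n).indicator
      (fun ω => deriv (ℓ (Y ω)) (q ω)) ω
      = (tameSet ℓ Y q 0 n).indicator (fun ω => deriv (ℓ (Y ω)) (q ω) ^ 2) ω := by
    intro ω
    simp only [indicator]
    split_ifs <;> ring
  have hi1 := M.integrable_deriv_mul hqm ht1
  have hi2 := M.integrable_deriv_mul hqm ht2
  refine ⟨by simpa only [e2] using hi2, ?_⟩
  -- The test direction is truncated `G` minus ε times the truncated score. Truncation and score
  -- each move it by at most c / 2 from `G`; the added 1 keeps the denominator positive.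
  set ε := c / 2 / (‖ht2.memLp.toLp (μ := P) _‖ + 1) with hε
  have hε0 : 0 < ε := by positivity
  have ht := ht1.add_const_mul ht2 (-ε)
  have hnorm : ‖M.memLp_G.toLp G - (ht.memLp (P := P)).toLp _‖ ≤ c := by
    have d1 : M.memLp_G.toLp G - (ht.memLp (P := P)).toLp _
        = (M.memLp_G.sub (ht1.memLp (P := P))).toLp _ + ε • (ht2.memLp (P := P)).toLp _ := by
      have : (ht.memLp (P := P)).toLp _
          = (ht1.memLp (P := P)).toLp _ + (-ε) • (ht2.memLp (P := P)).toLp _ := rfl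
      rw [this, MemLp.toLp_sub M.memLp_G (ht1.memLp (P := P))]
      module
    rw [d1]
    refine (norm_add_le _ _).trans ?_
    have b1 : ‖(M.memLp_G.sub (ht1.memLp (P := P))).toLp _‖ ≤ c / 2 := by
      refine le_of_sq_le_sq ?_ (by positivity)
      rw [norm_toLp_sq_eq_integral]
      exact hn.le
    have b2 : ‖ε • (ht2.memLp (P := P)).toLp _‖ ≤ c / 2 := by
      rw [norm_smul, Real.norm_of_nonneg hε0.le, hε, div_mul_eq_mul_div,
        div_le_iff₀ (by positivity)]
      nlinarith [norm_nonneg ((ht2.memLp (P := P)).toLp _)]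
    linarith
  -- Starting from `a U`, every direction within distance `c` of `G` stays in the cone.
  have hpos := M.integral_deriv_mul_nonneg_of_feasible hqm hxq hfin hmin ht (by
    filter_upwards [self_mem_nhdsWithin] with η hη
    have hη0 : 0 < η := hη
    refine ⟨a, η, hη0.le, ?_⟩
    have e3 : a • M.memLp_U.toLp U + η • M.memLp_G.toLp G - (x + η • (ht.memLp (P := P)).toLp _)
        = η • (M.memLp_G.toLp G - (ht.memLp (P := P)).toLp _) := by
      rw [← hxa]
      module
    rw [e3, norm_smul, Real.norm_of_nonneg hη0.le, mul_comm]
    exact mul_le_mul_of_nonneg_right hnorm hη0.le)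
  have e4 : ∀ ω, deriv (ℓ (Y ω)) (q ω) * ((tameSet ℓ Y q 0 n).indicator
        ({ω | |G ω| ≤ n}.indicator G) ω + -ε * (tameSet ℓ Y q 0 n).indicator
        (fun ω => deriv (ℓ (Y ω)) (q ω)) ω)
      = deriv (ℓ (Y ω)) (q ω) * (tameSet ℓ Y q 0 n).indicator ({ω | |G ω| ≤ n}.indicator G) ω
        - ε * (deriv (ℓ (Y ω)) (q ω) * (tameSet ℓ Y q 0 n).indicator
          (fun ω => deriv (ℓ (Y ω)) (q ω)) ω) := fun ω => by ring
  -- Independence removes the `G` part, leaving -ε times the integral of the squared truncated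
  -- score, which must then be zero.
  have e5 : ∫ ω, deriv (ℓ (Y ω)) (q ω) * (tameSet ℓ Y q 0 n).indicator
      ({ω | |G ω| ≤ n}.indicator G) ω ∂P = 0 := by
    rw [← M.integral_score_mul_truncated_gauss a n]
    refine integral_congr_ae (Eventually.of_forall fun ω => ?_)
    simp only [indicator, hq]
    split_ifs <;> ring
  simp only [e4] at hpos
  rw [integral_sub hi1 (hi2.const_mul ε), e5, integral_const_mul] at hpos
  simp only [e2] at hpos
  nlinarith

/-- The Lagrange multiplier rule at a minimizer over the cone. -/
theorem exists_multiplier {q r s : Ω → ℝ} (hq : Measurable q) (hr : Measurable r)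
    (hr2 : MemLp r 2 P) (hs : ∀ ω, s ω = deriv (ℓ (Y ω)) (q ω)) (hr0 : ¬ ∀ᵐ ω ∂P, r ω = 0)
    (h : ∀ e, IsTestFunction ℓ Y q e → 0 < ∫ ω, r ω * e ω ∂P → 0 ≤ ∫ ω, s ω * e ω ∂P) :
    ∃ k : ℝ, 0 ≤ k ∧ ∀ e, IsTestFunction ℓ Y q e →
      k * ∫ ω, r ω * e ω ∂P ≤ ∫ ω, s ω * e ω ∂P := by
  have hre : ∀ {e}, IsTestFunction ℓ Y q e → Integrable (fun ω => r ω * e ω) P := fun he =>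
    hr2.integrable_mul he.memLp
  have hse : ∀ {e}, IsTestFunction ℓ Y q e → Integrable (fun ω => s ω * e ω) P := fun he => by
    simpa only [hs] using M.integrable_deriv_mul hq he
  -- A truncation of `r` serves as the reference direction `e₀`; the multiplier is the ratio of its
  -- pairings with `s` and `r`.
  have hex : ∃ n : ℕ, 0 < ∫ ω, (tameSet ℓ Y q r n).indicator (fun ω => r ω ^ 2) ω ∂P := by
    by_contra! hcon
    refine hr0 (ae_eq_zero_of_eventually_integral_tameSet_le ℓ Y q r
      (Eventually.of_forall fun n => ⟨?_, hcon n⟩))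
    exact hr2.integrable_sq.indicator (M.measurableSet_tameSet hq hr n)
  obtain ⟨n, hn⟩ := hex
  have ht : IsTestFunction ℓ Y q ((tameSet ℓ Y q r n).indicator r) :=
    M.isTestFunction_indicator hq hr hr n (N := n) fun ω h _ => h
  set e₀ := (tameSet ℓ Y q r n).indicator r with he₀
  have hX : 0 < ∫ ω, r ω * e₀ ω ∂P := by
    convert hn using 3 with ω
    simp only [he₀, indicator]
    split_ifs <;> ring
  have hZ := h e₀ ht hX
  refine ⟨(∫ ω, s ω * e₀ ω ∂P) / ∫ ω, r ω * e₀ ω ∂P, by positivity, fun e he => ?_⟩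
  set X := ∫ ω, r ω * e₀ ω ∂P with hXd
  set Z := ∫ ω, s ω * e₀ ω ∂P with hZd
  refine le_of_forall_pos_le_add fun ε hε => ?_
  -- Correcting `e` by this multiple of `e₀` makes its pairing with `r` barely positive, as `h`
  -- requires; the cost is at most ε.
  set k := -(∫ ω, r ω * e ω ∂P) / X + ε / (Z + 1) with hkd
  have hte := he.add_const_mul ht k
  have i1 : ∫ ω, r ω * (e ω + k * e₀ ω) ∂P = (∫ ω, r ω * e ω ∂P) + k * X := by
    have : ∀ ω, r ω * (e ω + k * e₀ ω) = r ω * e ω + k * (r ω * e₀ ω) := fun ω => by ring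
    simp only [this]
    rw [integral_add (hre he) ((hre ht).const_mul k), integral_const_mul]
  have i2 : ∫ ω, s ω * (e ω + k * e₀ ω) ∂P = (∫ ω, s ω * e ω ∂P) + k * Z := by
    have : ∀ ω, s ω * (e ω + k * e₀ ω) = s ω * e ω + k * (s ω * e₀ ω) := fun ω => by ring
    simp only [this]
    rw [integral_add (hse he) ((hse ht).const_mul k), integral_const_mul]
  have hpos : 0 < (∫ ω, r ω * e ω ∂P) + k * X := by
    have : (∫ ω, r ω * e ω ∂P) + k * X = ε / (Z + 1) * X := by
      rw [hkd]
      field_simp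
      ring
    rw [this]
    positivity
  have hfin := h _ hte (i1 ▸ hpos)
  rw [i2, hkd] at hfin
  have h1 : ε / (Z + 1) * Z ≤ ε := by
    rw [div_mul_eq_mul_div, div_le_iff₀ (by positivity)]
    nlinarith
  have h2 : (-(∫ ω, r ω * e ω ∂P) / X + ε / (Z + 1)) * Z
      = -(Z / X * ∫ ω, r ω * e ω ∂P) + ε / (Z + 1) * Z := by ring
  linarith

/-- Testing with the truncation of `k * r - s` makes the inequality bound an integral of (s - k r)²
by zero. -/
theorem ae_eq_of_multiplier {q r s : Ω → ℝ} (hq : Measurable q) (hr : Measurable r)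
    (hr2 : MemLp r 2 P) (hs : ∀ ω, s ω = deriv (ℓ (Y ω)) (q ω)) {k : ℝ}
    (h : ∀ e, IsTestFunction ℓ Y q e → k * ∫ ω, r ω * e ω ∂P ≤ ∫ ω, s ω * e ω ∂P) :
    ∀ᵐ ω ∂P, s ω - k * r ω = 0 := by
  have hsm : Measurable s := by
    rw [funext hs]
    exact (measurable_deriv_loss_uncurry M.smooth M.meas).comp (M.measurable_Y.prodMk hq)
  refine ae_eq_zero_of_eventually_integral_tameSet_le ℓ Y q r (Eventually.of_forall fun n => ?_)
  have ht : IsTestFunction ℓ Y q ((tameSet ℓ Y q r n).indicator fun ω => k * r ω - s ω) := by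
    refine M.isTestFunction_indicator hq hr ((hr.const_mul k).sub hsm) n
      (N := |k| * n + n) fun ω h1 h2 => ?_
    refine (abs_sub _ _).trans ?_
    rw [abs_mul, hs]
    gcongr
  have hre : Integrable (fun ω => r ω * (tameSet ℓ Y q r n).indicator
    (fun ω => k * r ω - s ω) ω) P := hr2.integrable_mul ht.memLp
  have hse : Integrable (fun ω => s ω * (tameSet ℓ Y q r n).indicator
      (fun ω => k * r ω - s ω) ω) P := by
    simpa only [← hs] using M.integrable_deriv_mul hq ht
  have hle := h _ ht
  rw [← integral_const_mul, ← sub_nonneg, ← integral_sub hse (hre.const_mul k)] at hle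
  have e : ∀ ω, (tameSet ℓ Y q r n).indicator (fun ω => (s ω - k * r ω) ^ 2) ω
      = -(s ω * (tameSet ℓ Y q r n).indicator (fun ω => k * r ω - s ω) ω
        - k * (r ω * (tameSet ℓ Y q r n).indicator (fun ω => k * r ω - s ω) ω)) := by
    intro ω
    simp only [indicator]
    split_ifs <;> ring
  constructor
  · rw [funext e]
    exact (hse.sub (hre.const_mul k)).neg
  · simp only [e]
    rw [integral_neg]
    linarith

theorem exists_isSystemSolution {δ : ℝ} (hδ : 1 < δ) (hthr : δ⁻¹ < ⨅ t, phi ℓ P U G Y t) :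
    ∃ γ a σ : ℝ, IsSystemSolution ℓ P U G Y δ γ a σ := by
  have hδ0 : 0 < δ⁻¹ := by positivity
  have hδ1 : δ⁻¹ < 1 := inv_lt_one_of_one_lt₀ hδ
  set c := √δ⁻¹ with hcd
  have hc : 0 < c := Real.sqrt_pos.2 hδ0
  have hcsq : c ^ 2 = δ⁻¹ := Real.sq_sqrt hδ0.le
  have hc1 : c < 1 := by nlinarith
  have hk : 0 < 1 - c ^ 2 := by rw [hcsq]; linarith
  obtain ⟨x, hx, hfin, hmin⟩ := M.exists_minimizer hc hc1 (hcsq ▸ hthr)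
  have hG := M.inner_G_pos_of_minimizer hc hc1 hx hfin hmin
  obtain ⟨-, hQ⟩ := (mem_ballCone_iff M.norm_toLp_U M.norm_toLp_G M.inner_toLp_U_G hc hc1).1 hx
  set a := ⟪M.memLp_U.toLp U, x⟫ with ha
  -- These `a` and `σ` are the optimal parameters in the description of the cone, so the last two
  -- equations hold by orthonormality.
  set σ := ⟪M.memLp_G.toLp G, x⟫ / (1 - c ^ 2) with hσd
  have hσ : 0 < σ := div_pos hG hk
  have hqm : Measurable x := (Lp.stronglyMeasurable x).measurable
  set r : Ω → ℝ := fun ω => a * U ω + σ * G ω - x ω with hr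
  have hrm : Measurable r :=
    ((M.measurable_U.const_mul a).add (M.measurable_G.const_mul σ)).sub hqm
  have hr2 : MemLp r 2 P := (M.memLp_comb a σ).sub (Lp.memLp x)
  have hres : coneResidual (M.memLp_U.toLp U) (M.memLp_G.toLp G) c x = hr2.toLp r := by
    have : hr2.toLp r = a • M.memLp_U.toLp U + σ • M.memLp_G.toLp G
        - (Lp.memLp x).toLp x := rfl
    rw [this, Lp.toLp_coeFn, coneResidual]
  have hfirst : ∀ e, IsTestFunction ℓ Y x e →
      (coneForm (M.memLp_U.toLp U) (M.memLp_G.toLp G) c x < 0 ∨ 0 < ∫ ω, r ω * e ω ∂P) →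
      0 ≤ ∫ ω, deriv (ℓ (Y ω)) (x ω) * e ω ∂P := by
    intro e he h
    refine M.integral_deriv_mul_nonneg_of_feasible hqm EventuallyEq.rfl hfin hmin he ?_
    refine eventually_add_smul_mem_ballCone M.norm_toLp_U M.norm_toLp_G M.inner_toLp_U_G hc hc1
      hG (h.imp_right fun h => ⟨hQ, ?_⟩)
    rwa [hres, inner_toLp_eq_integral]
  have hnorm : ∫ ω, r ω ^ 2 ∂P
      = coneForm (M.memLp_U.toLp U) (M.memLp_G.toLp G) c x + c ^ 2 * σ ^ 2 := by
    rw [← norm_toLp_sq_eq_integral hr2, ← hres]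
    exact norm_sq_coneResidual M.norm_toLp_U M.norm_toLp_G M.inner_toLp_U_G hk.ne' x
  -- If the form were negative, every test direction would be feasible and the score would vanish
  -- almost surely.
  have hQ0 : coneForm (M.memLp_U.toLp U) (M.memLp_G.toLp G) c x = 0 := by
    refine le_antisymm hQ (not_lt.1 fun hneg => M.not_deriv_ae_eq_zero (q := x) ?_)
    have := M.ae_eq_of_multiplier (k := 0) hqm hrm hr2 (fun ω => rfl) fun e he => by
      rw [zero_mul]
      exact hfirst e he (Or.inl hneg)
    simpa using this
  rw [hQ0, zero_add, hcsq] at hnorm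
  have hr0 : ¬ ∀ᵐ ω ∂P, r ω = 0 := by
    intro h
    have h1 : ∫ ω, r ω ^ 2 ∂P = 0 := by
      rw [integral_congr_ae (g := fun _ => (0 : ℝ)), integral_zero]
      filter_upwards [h] with ω hω
      rw [hω, zero_pow two_ne_zero]
    rw [h1, ← hcsq] at hnorm
    have : 0 < c ^ 2 * σ ^ 2 := by positivity
    linarith
  obtain ⟨k, hk0, hkle⟩ := M.exists_multiplier hqm hrm hr2 (fun ω => rfl) hr0
    fun e he h => hfirst e he (Or.inr h)
  have hae := M.ae_eq_of_multiplier hqm hrm hr2 (fun ω => rfl) hkle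
  have hkpos : 0 < k := by
    refine lt_of_le_of_ne hk0 fun h => M.not_deriv_ae_eq_zero (q := x) ?_
    rw [← h] at hae
    simpa using hae
  -- The relation score = k · residual is the optimality equation of the proximal map with γ = 1/k.
  have hprox : ∀ᵐ ω ∂P, a * U ω + σ * G ω - proxVar ℓ U G Y k⁻¹ a σ ω = r ω := by
    filter_upwards [hae] with ω hω
    have h1 : a * U ω + σ * G ω - x ω = k⁻¹ * deriv (ℓ (Y ω)) (x ω) := by
      rw [sub_eq_zero.1 hω]
      field_simp
      rfl
    have := ((M.convex (Y ω)).convexOn.eq_prox_iff (M.differentiable _) (inv_pos.2 hkpos)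
      (a * U ω + σ * G ω) (x ω)).2 h1
    rw [proxVar, ← this]
  have hgu : ⟪M.memLp_G.toLp G, M.memLp_U.toLp U⟫ = 0 := by
    rw [real_inner_comm, M.inner_toLp_U_G]
  refine ⟨k⁻¹, a, σ, M.isSystemSolution_iff.2 ⟨inv_pos.2 hkpos, hσ, ?_, ?_, ?_⟩⟩
  · rw [← hnorm]
    refine integral_congr_ae ?_
    filter_upwards [hprox] with ω hω
    rw [hω]
  · have : ∫ ω, U ω * r ω ∂P = 0 := by
      rw [← inner_toLp_eq_integral M.memLp_U hr2, ← hres, coneResidual, inner_sub_right,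
        inner_add_right, inner_smul_right, inner_smul_right, M.inner_toLp_U_G,
        real_inner_self_eq_norm_sq, M.norm_toLp_U]
      ring
    rw [← this]
    refine integral_congr_ae ?_
    filter_upwards [hprox] with ω hω
    rw [hω]
  · have : ∫ ω, G ω * r ω ∂P = σ * δ⁻¹ := by
      rw [← inner_toLp_eq_integral M.memLp_G hr2, ← hres, coneResidual, inner_sub_right,
        inner_add_right, inner_smul_right, inner_smul_right, hgu,
        real_inner_self_eq_norm_sq, M.norm_toLp_G, ← hcsq, hσd]
      field_simp
      ring
    rw [← this]
    refine integral_congr_ae ?_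
    filter_upwards [hprox] with ω hω
    rw [hω]

end IsLossModel

/-! ### The growth assumption in terms of the excess, and the conclusion. -/

theorem abs_excess_le_of_growth {𝒴 : Set ℝ} {ℓ : 𝒴 → ℝ → ℝ} {y : 𝒴} {b d u : ℝ} (hb : 0 < b)
    (htri : y ∈ coerciveLabels ℓ ∨ y ∈ increasingLabels ℓ ∨ y ∈ decreasingLabels ℓ)
    (hi : y ∈ increasingLabels ℓ → -d + 1 / b * u ≤ ℓ y u)
    (hc : y ∈ coerciveLabels ℓ → -d + 1 / b * |u| ≤ ℓ y u)
    (hd : y ∈ decreasingLabels ℓ → -d + 1 / b * (-u) ≤ ℓ y u)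
    (hpos : 0 ≤ ℓ y u + d) : |excess ℓ y u| ≤ b * (ℓ y u + d) := by
  have key : ∀ v : ℝ, -d + 1 / b * v ≤ ℓ y u → v ≤ b * (ℓ y u + d) := by
    intro v hv
    have h1 : 1 / b * v ≤ ℓ y u + d := by linarith
    rwa [one_div, inv_mul_le_iff₀ hb] at h1
  have h0 : 0 ≤ b * (ℓ y u + d) := mul_nonneg hb.le hpos
  rcases htri with h | h | h
  · rw [excess_of_coercive h]
    exact key _ (hc h)
  · rw [excess_of_increasing h, abs_of_nonneg (le_max_right _ _)]
    exact max_le (key _ (hi h)) h0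
  · rw [excess_of_decreasing h, abs_of_nonpos (min_le_right _ _), ← max_neg_neg, neg_zero]
    exact max_le (key _ (hd h)) h0

theorem theorem2p2
    {Ω : Type*} [MeasurableSpace Ω] (P : Measure Ω) [IsProbabilityMeasure P]
    (𝒴 : Set ℝ) (ℓ : 𝒴 → ℝ → ℝ) (U G : Ω → ℝ) (Y : Ω → 𝒴)
    -- `U` and `G` are standard normal and `G` is independent of `(U, Y)`
    (hU : Measurable U) (hG : Measurable G) (hY : Measurable Y)
    (hU_law : P.map U = gaussianReal 0 1) (hG_law : P.map G = gaussianReal 0 1)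
    (h_indep : IndepFun G (fun ω => (U ω, Y ω)) P)
    -- the loss is measurable in the label, and `C¹` and strictly convex in its argument
    (hℓ_meas : ∀ u : ℝ, Measurable fun y : 𝒴 => ℓ y u)
    (hℓ_smooth : ∀ y, ContDiff ℝ 1 (ℓ y))
    (hℓ_convex : ∀ y, StrictConvexOn ℝ univ (ℓ y))
    -- non-triviality of the law of `(U, Y)`
    (h_nontrivial₁ : 0 < ∫ ω, ((Y ⁻¹' coerciveLabels ℓ)
        ∪ (Y ⁻¹' decreasingLabels ℓ ∩ {ω | 0 < U ω})
        ∪ (Y ⁻¹' increasingLabels ℓ ∩ {ω | U ω < 0})).indicator (fun ω => U ω ^ 2) ω ∂P)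
    (h_nontrivial₂ : 0 < ∫ ω, ((Y ⁻¹' coerciveLabels ℓ)
        ∪ (Y ⁻¹' decreasingLabels ℓ ∩ {ω | U ω < 0})
        ∪ (Y ⁻¹' increasingLabels ℓ ∩ {ω | 0 < U ω})).indicator (fun ω => U ω ^ 2) ω ∂P)
    -- `inf_u ℓ_Y(u)` (almost surely finite) and `ℓ_Y(G)` are integrable
    (h_bdd : ∀ᵐ ω ∂P, BddBelow (range (ℓ (Y ω))))
    (h_inf : Integrable (fun ω => ⨅ u : ℝ, ℓ (Y ω) u) P)
    (h_gauss : Integrable (fun ω => ℓ (Y ω) (G ω)) P)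
    -- the loss is not almost surely coercive
    (h_not_coercive : P (Y ⁻¹' coerciveLabels ℓ) < 1)
    -- at least linear growth in the directions of divergence
    (h_growth : ∃ b : ℝ, 0 < b ∧ ∃ D : 𝒴 → ℝ, Measurable D ∧ (∀ᵐ ω ∂P, 0 < D (Y ω)) ∧
        Integrable (fun ω => D (Y ω)) P ∧
        Integrable ((Y ⁻¹' coerciveLabels ℓ).indicator fun ω => D (Y ω) ^ 2) P ∧
        ∀ᵐ ω ∂P, ∀ u : ℝ,
          (Y ω ∈ increasingLabels ℓ → -D (Y ω) + 1 / b * u ≤ ℓ (Y ω) u) ∧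
          (Y ω ∈ coerciveLabels ℓ → -D (Y ω) + 1 / b * |u| ≤ ℓ (Y ω) u) ∧
          (Y ω ∈ decreasingLabels ℓ → -D (Y ω) + 1 / b * (-u) ≤ ℓ (Y ω) u))
    (δ : ℝ) (hδ : 1 < δ) :
    -- all expectations in the system are finite
    (∀ γ a σ : ℝ, 0 < γ → 0 < σ →
      Integrable (fun ω => scoreVar ℓ U G Y γ a σ ω ^ 2) P ∧
      Integrable (fun ω => U ω * scoreVar ℓ U G Y γ a σ ω) P ∧
      Integrable (fun ω => G ω * proxVar ℓ U G Y γ a σ ω) P) ∧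
    -- no solution up to the threshold, a unique one above it
    (ENNReal.ofReal δ ≤ criticalThreshold ℓ P U G Y →
      ¬ ∃ γ a σ : ℝ, IsSystemSolution ℓ P U G Y δ γ a σ) ∧
    (criticalThreshold ℓ P U G Y < ENNReal.ofReal δ →
      ∃! s : ℝ × ℝ × ℝ, IsSystemSolution ℓ P U G Y δ s.1 s.2.1 s.2.2) := by
  have M : IsLossModel P ℓ U G Y :=
    { measurable_U := hU
      measurable_G := hG
      measurable_Y := hY
      law_U := hU_law
      law_G := hG_law
      indep := h_indep
      meas := hℓ_meas
      smooth := hℓ_smooth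
      convex := hℓ_convex
      nontrivial_neg := h_nontrivial₁
      nontrivial_pos := h_nontrivial₂
      bddBelow := h_bdd
      integrable_inf := h_inf
      integrable_gauss := h_gauss
      not_coercive := h_not_coercive
      growth := by
        obtain ⟨b, hb, D, -, hD0, hD, -, hgr⟩ := h_growth
        -- Adding the absolute infimum makes loss plus `D` nonnegative, also where the excess is
        -- zero and the growth bound gives no information.
        refine ⟨b, hb, fun ω => D (Y ω) + |⨅ u : ℝ, ℓ (Y ω) u|, hD.add h_inf.abs, ?_⟩
        filter_upwards [hgr, hD0, h_bdd] with ω h h0 hbd u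
        have hinf := ciInf_le hbd u
        have habs := neg_abs_le (⨅ u : ℝ, ℓ (Y ω) u)
        have hnn := abs_nonneg (⨅ u : ℝ, ℓ (Y ω) u)
        obtain ⟨h1, h2, h3⟩ := h u
        exact abs_excess_le_of_growth hb (label_trichotomy hℓ_smooth hℓ_convex (Y ω))
          (fun k => by linarith [h1 k]) (fun k => by linarith [h2 k])
          (fun k => by linarith [h3 k]) (by linarith) }
  refine ⟨fun γ a σ hγ _ => ⟨(M.memLp_scoreVar hγ a σ).integrable_sq,
    M.memLp_U.integrable_mul (M.memLp_scoreVar hγ a σ),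
    M.memLp_G.integrable_mul (M.memLp_proxVar hγ a σ)⟩, fun hle => ?_, fun hlt => ?_⟩
  · rintro ⟨γ, a, σ, h⟩
    exact M.not_isSystemSolution hδ ((IsLossModel.le_criticalThreshold_iff (zero_lt_one.trans hδ)).1 hle)
      γ a σ h
  · have hthr : δ⁻¹ < ⨅ t, phi ℓ P U G Y t := by
      rw [← not_le, ← IsLossModel.le_criticalThreshold_iff (zero_lt_one.trans hδ), not_le]
      exact hlt
    obtain ⟨γ, a, σ, h⟩ := M.exists_isSystemSolution hδ hthr
    refine ⟨(γ, a, σ), h, ?_⟩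
    rintro ⟨γ', a', σ'⟩ h'
    obtain ⟨rfl, rfl, rfl⟩ := M.isSystemSolution_unique hδ h' h
    rfl
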